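/- Let $q\in(0,1)$. For $n\ge 1$ let $C(SU_q(n))$ be the universal unital $C^*$-algebra generated by elements $u^n_{ij}$, $1\le i,j\le n$, subject to $$\sum_{k}u^n_{ik}(u^n_{jk})^*=\delta_{ij}1,\qquad \sum_k (u^n_{ki})^*u^n_{kj}=\delta_{ij}1,\qquad \sum_{i_1,\dots,i_n=1}^n E_{i_1\cdots i_n}\,u^n_{j_1i_1}\cdots u^n_{j_ni_n}=E_{j_1\cdots j_n}1$$ for all indices, where $E_{i_1\cdots i_n}=0$ if $i_1,\dots,i_n$ are not distinct and $E_{i_1\cdots i_n}=(-q)^{\ell(i_1,\dots,i_n)}$ otherwise, $\ell$ being the number of inversions. Write $\hat\otimes$ for the minimal (spatial) tensor product. Inverse limits of $C^*$-algebras are taken in the category of topological $*$-algebras. For sequences $(A_n)$, $(B_n)$ of unital $C^*$-algebras with surjective unital connecting $*$-homomorphisms put $(\varprojlim A_n)\hat\otimes(\varprojlim B_n)=\varprojlim (A_n\hat\otimes B_n)$. A unital $\sigma$-$C^*$-algebra $A=\varprojlim A_n$ with a (continuous) unital $*$-homomorphism $\Delta:A\to A\hat\otimes A$ is a $\sigma$-$C^*$-quantum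 group if $(\Delta\hat\otimes\mathrm{id})\Delta=(\mathrm{id}\hat\otimes\Delta)\Delta$ and the linear spans of $\Delta(A)(A\hat\otimes1)$ and of $\Delta(A)(1\hat\otimes A)$ are dense in $A\hat\otimes A$. Then there are surjective unital $*$-homomorphisms $\theta_n:C(SU_q(n))\to C(SU_q(n-1))$, $n\ge2$, with $\theta_n(u^n_{ij})=u^{n-1}_{ij}$ if $i,j\le n-1$ and $\theta_n(u^n_{ij})=\delta_{ij}1$ otherwise, and unital $*$-homomorphisms $\Delta_n:C(SU_q(n))\to C(SU_q(n))\hat\otimes C(SU_q(n))$, $n\ge 1$, with $\Delta_n(u^n_{ij})=\sum_k u^n_{ik}\otimes u^n_{kj}$; they satisfy $(\theta_n\hat\otimes\theta_n)\circ\Delta_n=\Delta_{n-1}\circ\theta_n$ for all $n\ge2$. Moreover $C(SU_q(\infty))=\varprojlim_n C(SU_q(n))$, with the comultiplication $\Delta=\varprojlim_n\Delta_n$, is a $\sigma$-$C^*$-quantum group. -/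

import Mathlib

open scoped TensorProduct
open UniformSpace

universe u v w

noncomputable section

/-! ### Hausdorff completion of a `*`-algebra with respect to a C*-seminorm -/

/-- A C*-seminorm on a complex unital `*`-algebra. -/
structure CStarSeminorm (P : Type u) [Ring P] [Algebra ℂ P] [StarRing P] extends
    Seminorm ℂ P where
  mul_le' : ∀ x y, toFun (x * y) ≤ toFun x * toFun y
  cstar' : ∀ x, toFun (star x * x) = toFun x * toFun x

namespace CStarSeminorm

variable {P : Type u} [Ring P] [Algebra ℂ P] [StarRing P]

lemma star_le (p : CStarSeminorm P) (x : P) : p.toFun x ≤ p.toFun (star x) := by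
  have h1 := p.mul_le' (star x) x
  rw [p.cstar'] at h1
  by_contra! h
  have h0 : 0 ≤ p.toFun (star x) := apply_nonneg p.toSeminorm _
  have h2 : 0 < p.toFun x := h0.trans_lt h
  have := mul_lt_mul_of_pos_right h h2
  linarith

lemma star_eq (p : CStarSeminorm P) (x : P) : p.toFun (star x) = p.toFun x :=
  le_antisymm (by simpa using p.star_le (star x)) (p.star_le x)

/-- A copy of `P`, seminormed by `p`. -/
@[nolint unusedArguments]
def Carrier (_p : CStarSeminorm P) : Type u := P

variable (p : CStarSeminorm P)

instance : Ring p.Carrier := inferInstanceAs (Ring P)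
instance : Algebra ℂ p.Carrier := inferInstanceAs (Algebra ℂ P)
instance : StarRing p.Carrier := inferInstanceAs (StarRing P)
instance [StarModule ℂ P] : StarModule ℂ p.Carrier := inferInstanceAs (StarModule ℂ P)

instance : SeminormedRing p.Carrier where
  norm := p.toFun
  dist x y := p.toFun (-x + y)
  dist_self x := by
    rw [neg_add_cancel]; exact p.map_zero'
  dist_comm x y := by
    rw [show -y + x = -(-x + y) by abel]
    exact (p.neg' (-x + y : P)).symm
  dist_triangle x y z := by
    rw [show -x + z = (-x + y) + (-y + z) by abel]
    exact p.add_le' (-x + y : P) (-y + z : P)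
  dist_eq _ _ := rfl
  norm_mul_le := p.mul_le'

lemma norm_def (x : p.Carrier) : ‖x‖ = p.toFun x := rfl

instance : NormedAlgebra ℂ p.Carrier :=
  { (inferInstance : Algebra ℂ p.Carrier) with
    norm_smul_le := fun r x => (p.smul' r x).le }

instance : NormedStarGroup p.Carrier where
  norm_star_le := fun x => (p.star_eq x).le

/-- The Hausdorff completion of `P` with respect to `p`, a C*-algebra. -/
def Completion : Type u := UniformSpace.Completion p.Carrier

instance : NormedRing p.Completion := inferInstanceAs (NormedRing (UniformSpace.Completion p.Carrier))
instance : NormedAlgebra ℂ p.Completion :=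
  { (inferInstanceAs (Algebra ℂ (UniformSpace.Completion p.Carrier)) :
      Algebra ℂ (UniformSpace.Completion p.Carrier)) with
    norm_smul_le := fun c x => norm_smul_le (β := UniformSpace.Completion p.Carrier) c x }
instance : CompleteSpace p.Completion :=
  inferInstanceAs (CompleteSpace (UniformSpace.Completion p.Carrier))

/-- The canonical map from `P` to its completion. -/
def coe (x : P) : p.Completion := UniformSpace.Completion.coe' (α := p.Carrier) x

lemma norm_coe (x : P) : ‖p.coe x‖ = p.toFun x :=
  UniformSpace.Completion.norm_coe (E := p.Carrier) x

lemma continuous_coe : Continuous (fun x : p.Carrier => p.coe x) :=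
  UniformSpace.Completion.continuous_coe _

lemma coe_add (x y : P) : p.coe (x + y) = p.coe x + p.coe y :=
  UniformSpace.Completion.coe_add (α := p.Carrier) x y
lemma coe_mul (x y : P) : p.coe (x * y) = p.coe x * p.coe y :=
  UniformSpace.Completion.coe_mul (α := p.Carrier) x y
lemma coe_one : p.coe 1 = 1 := UniformSpace.Completion.coe_one p.Carrier
lemma coe_zero : p.coe 0 = 0 := UniformSpace.Completion.coe_zero (α := p.Carrier)
lemma coe_smul (c : ℂ) (x : P) : p.coe (c • x) = c • p.coe x :=
  UniformSpace.Completion.coe_smul (X := p.Carrier) c x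

lemma denseRange_coe : DenseRange p.coe := UniformSpace.Completion.denseRange_coe (α := p.Carrier)

lemma ind {motive : p.Completion → Prop} (h : IsClosed {x | motive x})
    (hc : ∀ x : P, motive (p.coe x)) (x : p.Completion) : motive x :=
  UniformSpace.Completion.induction_on (α := p.Carrier) x h hc

lemma ind₂ {motive : p.Completion → p.Completion → Prop}
    (h : IsClosed {x : p.Completion × p.Completion | motive x.1 x.2})
    (hc : ∀ x y : P, motive (p.coe x) (p.coe y)) (x y : p.Completion) : motive x y :=
  UniformSpace.Completion.induction_on₂ (α := p.Carrier) (β := p.Carrier) x y h hc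

/-- The involution of the completion, the continuous extension of the one of `P`. -/
instance : Star p.Completion :=
  ⟨UniformSpace.Completion.map (α := p.Carrier) (β := p.Carrier) star⟩

lemma continuous_star' : Continuous (star : p.Completion → p.Completion) :=
  UniformSpace.Completion.continuous_map

lemma coe_star (x : P) : p.coe (star x) = star (p.coe x) :=
  (UniformSpace.Completion.map_coe (α := p.Carrier) (β := p.Carrier)
    (star_isometry (E := p.Carrier)).uniformContinuous x).symm

instance : StarRing p.Completion where
  star_involutive := p.ind
    (isClosed_eq (p.continuous_star'.comp p.continuous_star') continuous_id)
    (fun x => by rw [← coe_star, ← coe_star, star_star])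
  star_mul := p.ind₂
    (isClosed_eq (p.continuous_star'.comp (continuous_fst.mul continuous_snd))
      ((p.continuous_star'.comp continuous_snd).mul (p.continuous_star'.comp continuous_fst)))
    (fun x y => by rw [← coe_mul, ← coe_star, star_mul, coe_mul, coe_star, coe_star])
  star_add := p.ind₂
    (isClosed_eq (p.continuous_star'.comp (continuous_fst.add continuous_snd))
      ((p.continuous_star'.comp continuous_fst).add (p.continuous_star'.comp continuous_snd)))
    (fun x y => by rw [← coe_add, ← coe_star, star_add, coe_add, coe_star, coe_star])

instance [StarModule ℂ P] : StarModule ℂ p.Completion where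
  star_smul c := p.ind
    (isClosed_eq (p.continuous_star'.comp (continuous_const_smul c))
      (p.continuous_star'.const_smul (star c)))
    (fun x => by rw [← coe_smul, ← coe_star, star_smul, coe_smul, coe_star])

instance : CStarRing p.Completion where
  norm_mul_self_le := p.ind
    (isClosed_le (by fun_prop) ((p.continuous_star'.mul continuous_id).norm))
    (fun x => by rw [← coe_star, ← coe_mul, norm_coe, norm_coe, p.cstar'])

instance [StarModule ℂ P] : CStarAlgebra p.Completion where

/-- The canonical `*`-homomorphism from `P` to its completion. -/
def coeHom : P →⋆ₐ[ℂ] p.Completion where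
  toFun := p.coe
  map_one' := p.coe_one
  map_mul' := p.coe_mul
  map_zero' := p.coe_zero
  map_add' := p.coe_add
  commutes' c := by
    rw [Algebra.algebraMap_eq_smul_one, coe_smul, coe_one, ← Algebra.algebraMap_eq_smul_one]
  map_star' := p.coe_star

/-- A `*`-homomorphism dominated by `p`, as a continuous linear map. -/
def toCLM {D : Type w} [CStarAlgebra D] (φ : P →⋆ₐ[ℂ] D) (h : ∀ x, ‖φ x‖ ≤ p.toFun x) :
    p.Carrier →L[ℂ] D :=
  LinearMap.mkContinuous (E := p.Carrier) (φ.toAlgHom.toLinearMap : P →ₗ[ℂ] D) 1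
    (fun x => by rw [one_mul]; exact h x)

/-- A `*`-homomorphism from `P` to a C*-algebra that is dominated by `p` extends to the
completion. -/
def lift {D : Type w} [CStarAlgebra D] (φ : P →⋆ₐ[ℂ] D) (h : ∀ x, ‖φ x‖ ≤ p.toFun x) :
    p.Completion →⋆ₐ[ℂ] D :=
  have hf : ∀ x : P, (p.toCLM φ h).fromCompletion (p.coe x) = φ x := fun x =>
    ContinuousLinearMap.fromCompletion_apply_coe (p.toCLM φ h) x
  have hc : Continuous ((p.toCLM φ h).fromCompletion : p.Completion → D) :=
    (p.toCLM φ h).fromCompletion.continuous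
  { toFun := (p.toCLM φ h).fromCompletion
    map_one' := by rw [← coe_one, hf, map_one]
    map_mul' := p.ind₂ (isClosed_eq (hc.comp (continuous_fst.mul continuous_snd))
        ((hc.comp continuous_fst).mul (hc.comp continuous_snd)))
      (fun x y => by rw [← coe_mul, hf, hf, hf, map_mul])
    map_zero' := map_zero (p.toCLM φ h).fromCompletion
    map_add' := map_add (p.toCLM φ h).fromCompletion
    commutes' := fun c => by
      rw [Algebra.algebraMap_eq_smul_one, ← coe_one, ← coe_smul, hf, map_smul, map_one,
        ← Algebra.algebraMap_eq_smul_one]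
    map_star' := p.ind (isClosed_eq (hc.comp p.continuous_star') (continuous_star.comp hc))
      (fun x => by rw [← coe_star, hf, hf, map_star]) }

@[simp] lemma lift_coe {D : Type w} [CStarAlgebra D] (φ : P →⋆ₐ[ℂ] D)
    (h : ∀ x, ‖φ x‖ ≤ p.toFun x) (x : P) : p.lift φ h (p.coe x) = φ x :=
  ContinuousLinearMap.fromCompletion_apply_coe (p.toCLM φ h) x

end CStarSeminorm

namespace CStarSeminorm

variable {P : Type u} [Ring P] [Algebra ℂ P] [StarRing P]

/-- The supremum of the C*-seminorms `x ↦ ‖φ i x‖` over a pointwise bounded family of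
`*`-homomorphisms into C*-algebras. -/
def ofFamily {ι : Type v} {B : ι → Type w} [∀ i, CStarAlgebra (B i)]
    (φ : ∀ i, P →⋆ₐ[ℂ] B i) (hb : ∀ x, BddAbove (Set.range fun i => ‖φ i x‖)) :
    CStarSeminorm P where
  toFun x := ⨆ i, ‖φ i x‖
  map_zero' := by simp
  add_le' x y := Real.iSup_le (fun i => by
      rw [map_add]
      exact (norm_add_le _ _).trans (add_le_add (le_ciSup (hb x) i) (le_ciSup (hb y) i)))
    (add_nonneg (Real.iSup_nonneg fun _ => norm_nonneg _)
      (Real.iSup_nonneg fun _ => norm_nonneg _))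
  neg' x := by simp
  smul' c x := by
    simp only [map_smul, norm_smul]
    rw [Real.mul_iSup_of_nonneg (norm_nonneg c)]
  mul_le' x y := Real.iSup_le (fun i => by
      rw [map_mul]
      exact (norm_mul_le _ _).trans (mul_le_mul (le_ciSup (hb x) i) (le_ciSup (hb y) i)
        (norm_nonneg _) (Real.iSup_nonneg fun _ => norm_nonneg _)))
    (mul_nonneg (Real.iSup_nonneg fun _ => norm_nonneg _)
      (Real.iSup_nonneg fun _ => norm_nonneg _))
  cstar' x := by
    have key : ∀ i, ‖φ i (star x * x)‖ = ‖φ i x‖ * ‖φ i x‖ := fun i => by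
      rw [map_mul, map_star, CStarRing.norm_star_mul_self]
    have h0 : 0 ≤ ⨆ i, ‖φ i x‖ := Real.iSup_nonneg fun _ => norm_nonneg _
    have h1 : 0 ≤ ⨆ i, ‖φ i (star x * x)‖ := Real.iSup_nonneg fun _ => norm_nonneg _
    apply le_antisymm
    · refine Real.iSup_le (fun i => ?_) (mul_nonneg h0 h0)
      rw [key]
      exact mul_self_le_mul_self (norm_nonneg _) (le_ciSup (hb x) i)
    · have h2 : ⨆ i, ‖φ i x‖ ≤ √(⨆ i, ‖φ i (star x * x)‖) := by
        refine Real.iSup_le (fun i => Real.le_sqrt_of_sq_le ?_) (Real.sqrt_nonneg _)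
        rw [sq, ← key]
        exact le_ciSup (hb (star x * x)) i
      calc _ ≤ √(⨆ i, ‖φ i (star x * x)‖) * √(⨆ i, ‖φ i (star x * x)‖) :=
            mul_self_le_mul_self h0 h2
        _ = _ := Real.mul_self_sqrt h1

lemma le_ofFamily {ι : Type v} {B : ι → Type w} [∀ i, CStarAlgebra (B i)]
    (φ : ∀ i, P →⋆ₐ[ℂ] B i) (hb : ∀ x, BddAbove (Set.range fun i => ‖φ i x‖)) (i : ι) (x : P) :
    ‖φ i x‖ ≤ (ofFamily φ hb).toFun x := le_ciSup (hb x) i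

lemma ofFamily_le {ι : Type v} {B : ι → Type w} [∀ i, CStarAlgebra (B i)]
    (φ : ∀ i, P →⋆ₐ[ℂ] B i) (hb : ∀ x, BddAbove (Set.range fun i => ‖φ i x‖)) (x : P) {c : ℝ}
    (hc : 0 ≤ c) (h : ∀ i, ‖φ i x‖ ≤ c) : (ofFamily φ hb).toFun x ≤ c := Real.iSup_le h hc

end CStarSeminorm

/-! ### Minimal (spatial) tensor products -/

section HilbertTensor

variable {H K : Type u} [NormedAddCommGroup H] [InnerProductSpace ℂ H]
  [NormedAddCommGroup K] [InnerProductSpace ℂ K]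

/-- The Hilbert space tensor product. -/
def HilbertTensor (H K : Type u) [NormedAddCommGroup H] [InnerProductSpace ℂ H]
    [NormedAddCommGroup K] [InnerProductSpace ℂ K] : Type u :=
  UniformSpace.Completion (H ⊗[ℂ] K)

instance : NormedAddCommGroup (HilbertTensor H K) :=
  inferInstanceAs (NormedAddCommGroup (UniformSpace.Completion (H ⊗[ℂ] K)))
instance : InnerProductSpace ℂ (HilbertTensor H K) :=
  inferInstanceAs (InnerProductSpace ℂ (UniformSpace.Completion (H ⊗[ℂ] K)))
instance : CompleteSpace (HilbertTensor H K) :=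
  inferInstanceAs (CompleteSpace (UniformSpace.Completion (H ⊗[ℂ] K)))

namespace HilbertTensor

/-- The canonical map from the algebraic tensor product to the Hilbert space tensor product. -/
def coe : (H ⊗[ℂ] K) →ₗᵢ[ℂ] HilbertTensor H K :=
  (UniformSpace.Completion.toComplₗᵢ : (H ⊗[ℂ] K) →ₗᵢ[ℂ] UniformSpace.Completion (H ⊗[ℂ] K))

lemma inner_coe (x y : H ⊗[ℂ] K) : inner ℂ (coe x) (coe y) = inner ℂ x y :=
  (coe (H := H) (K := K)).inner_map_map x y

lemma ind {motive : HilbertTensor H K → Prop} (h : IsClosed {x | motive x})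
    (hc : ∀ x : H ⊗[ℂ] K, motive (coe x)) (x : HilbertTensor H K) : motive x :=
  UniformSpace.Completion.induction_on (α := H ⊗[ℂ] K) x h hc

lemma ind₂ {motive : HilbertTensor H K → HilbertTensor H K → Prop}
    (h : IsClosed {x : HilbertTensor H K × HilbertTensor H K | motive x.1 x.2})
    (hc : ∀ x y : H ⊗[ℂ] K, motive (coe x) (coe y)) (x y : HilbertTensor H K) : motive x y :=
  UniformSpace.Completion.induction_on₂ (α := H ⊗[ℂ] K) (β := H ⊗[ℂ] K) x y h hc

end HilbertTensor

open HilbertTensor (coe)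

/-- The bounded operator `S ⊗ T` on the Hilbert space tensor product. -/
def opTensor (S : H →L[ℂ] H) (T : K →L[ℂ] K) : HilbertTensor H K →L[ℂ] HilbertTensor H K :=
  ((TensorProduct.mapL S T).completion :
    UniformSpace.Completion (H ⊗[ℂ] K) →L[ℂ] UniformSpace.Completion (H ⊗[ℂ] K))

@[simp] lemma opTensor_coe (S : H →L[ℂ] H) (T : K →L[ℂ] K) (x : H ⊗[ℂ] K) :
    opTensor S T (coe x) = coe (TensorProduct.mapL S T x) :=
  ContinuousLinearMap.completion_apply_coe (TensorProduct.mapL S T) x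

lemma hilbertTensor_ext {f g : HilbertTensor H K →L[ℂ] HilbertTensor H K}
    (h : ∀ x : H ⊗[ℂ] K, f (coe x) = g (coe x)) : f = g :=
  ContinuousLinearMap.ext (HilbertTensor.ind (isClosed_eq f.continuous g.continuous) h)

lemma opTensor_mul (S S' : H →L[ℂ] H) (T T' : K →L[ℂ] K) :
    opTensor (S * S') (T * T') = opTensor S T * opTensor S' T' :=
  hilbertTensor_ext fun x => by
    rw [mul_apply_eq_comp, opTensor_coe, opTensor_coe, opTensor_coe,
      TensorProduct.mapL_mul, mul_apply_eq_comp]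

lemma opTensor_one : opTensor (1 : H →L[ℂ] H) (1 : K →L[ℂ] K) = 1 :=
  hilbertTensor_ext fun x => by
    rw [opTensor_coe, one_apply_eq_self]
    congr 1
    exact congrArg (fun f : (H ⊗[ℂ] K) →L[ℂ] (H ⊗[ℂ] K) => f x) TensorProduct.mapL_id_id

lemma opTensor_add_left (S S' : H →L[ℂ] H) (T : K →L[ℂ] K) :
    opTensor (S + S') T = opTensor S T + opTensor S' T :=
  hilbertTensor_ext fun x => by
    rw [_root_.add_apply, opTensor_coe, opTensor_coe, opTensor_coe,
      TensorProduct.mapL_add_left, _root_.add_apply, map_add]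

lemma opTensor_add_right (S : H →L[ℂ] H) (T T' : K →L[ℂ] K) :
    opTensor S (T + T') = opTensor S T + opTensor S T' :=
  hilbertTensor_ext fun x => by
    rw [_root_.add_apply, opTensor_coe, opTensor_coe, opTensor_coe,
      TensorProduct.mapL_add_right, _root_.add_apply, map_add]

lemma opTensor_smul_left (c : ℂ) (S : H →L[ℂ] H) (T : K →L[ℂ] K) :
    opTensor (c • S) T = c • opTensor S T :=
  hilbertTensor_ext fun x => by
    rw [_root_.smul_apply, opTensor_coe, opTensor_coe,
      TensorProduct.mapL_smul_left, _root_.smul_apply, map_smul]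

lemma opTensor_smul_right (c : ℂ) (S : H →L[ℂ] H) (T : K →L[ℂ] K) :
    opTensor S (c • T) = c • opTensor S T :=
  hilbertTensor_ext fun x => by
    rw [_root_.smul_apply, opTensor_coe, opTensor_coe,
      TensorProduct.mapL_smul_right, _root_.smul_apply, map_smul]

lemma norm_opTensor_le (S : H →L[ℂ] H) (T : K →L[ℂ] K) : ‖opTensor S T‖ ≤ ‖S‖ * ‖T‖ := by
  refine ContinuousLinearMap.opNorm_le_bound _ (by positivity) (HilbertTensor.ind
    (isClosed_le (by fun_prop) (by fun_prop)) fun x => ?_)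
  rw [opTensor_coe, LinearIsometry.norm_map, LinearIsometry.norm_map]
  exact (ContinuousLinearMap.le_opNorm _ _).trans
    (mul_le_mul_of_nonneg_right (TensorProduct.norm_mapL_le _ _) (norm_nonneg _))

variable [CompleteSpace H] [CompleteSpace K]

lemma star_opTensor (S : H →L[ℂ] H) (T : K →L[ℂ] K) :
    star (opTensor S T) = opTensor (star S) (star T) := by
  rw [ContinuousLinearMap.star_eq_adjoint, eq_comm, ContinuousLinearMap.eq_adjoint_iff]
  refine HilbertTensor.ind₂ (isClosed_eq (by fun_prop) (by fun_prop)) fun x y => ?_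
  rw [opTensor_coe, opTensor_coe, HilbertTensor.inner_coe, HilbertTensor.inner_coe]
  induction x with
  | zero => simp
  | add a b ha hb => rw [map_add, inner_add_left, inner_add_left, ha, hb]
  | tmul a b =>
    induction y with
    | zero => simp
    | add c d hc hd => rw [map_add, inner_add_right, inner_add_right, hc, hd]
    | tmul c d =>
      rw [TensorProduct.mapL_tmul, TensorProduct.mapL_tmul, TensorProduct.inner_tmul,
        TensorProduct.inner_tmul, ContinuousLinearMap.star_eq_adjoint,
        ContinuousLinearMap.star_eq_adjoint, ContinuousLinearMap.adjoint_inner_left,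
        ContinuousLinearMap.adjoint_inner_left]

end HilbertTensor

section RepTensor

variable {P Q : Type u} [Ring P] [Algebra ℂ P] [StarRing P] [StarModule ℂ P]
  [Ring Q] [Algebra ℂ Q] [StarRing Q] [StarModule ℂ Q]
  {H K : Type u} [NormedAddCommGroup H] [InnerProductSpace ℂ H] [CompleteSpace H]
  [NormedAddCommGroup K] [InnerProductSpace ℂ K] [CompleteSpace K]

/-- The representation `π ⊗ ρ` of the algebraic tensor product `P ⊗ Q` on the Hilbert space
tensor product, `(π ⊗ ρ)(x ⊗ y) = π x ⊗ ρ y`. -/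
def repTensor (π : P →⋆ₐ[ℂ] (H →L[ℂ] H)) (ρ : Q →⋆ₐ[ℂ] (K →L[ℂ] K)) :
    (P ⊗[ℂ] Q) →⋆ₐ[ℂ] (HilbertTensor H K →L[ℂ] HilbertTensor H K) :=
  let L : (P ⊗[ℂ] Q) →ₗ[ℂ] (HilbertTensor H K →L[ℂ] HilbertTensor H K) :=
    TensorProduct.lift (LinearMap.mk₂ ℂ (fun x y => opTensor (π x) (ρ y))
      (fun x x' y => by rw [map_add, opTensor_add_left])
      (fun c x y => by rw [map_smul, opTensor_smul_left])
      (fun x y y' => by rw [map_add, opTensor_add_right])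
      (fun c x y => by rw [map_smul, opTensor_smul_right]))
  have hL : ∀ x y, L (x ⊗ₜ y) = opTensor (π x) (ρ y) := fun x y => rfl
  { Algebra.TensorProduct.algHomOfLinearMapTensorProduct L
      (fun x x' y y' => by rw [hL, hL, hL, map_mul, map_mul, opTensor_mul])
      (by rw [hL, map_one, map_one, opTensor_one]) with
    map_star' := fun z => by
      change L (star z) = star (L z)
      induction z with
      | zero => rw [star_zero, map_zero, star_zero]
      | add a b ha hb => rw [star_add, map_add, map_add, star_add, ha, hb]
      | tmul a b => rw [TensorProduct.star_tmul, hL, hL, map_star, map_star, star_opTensor] }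

@[simp] lemma repTensor_tmul (π : P →⋆ₐ[ℂ] (H →L[ℂ] H)) (ρ : Q →⋆ₐ[ℂ] (K →L[ℂ] K)) (x : P) (y : Q) :
    repTensor π ρ (x ⊗ₜ y) = opTensor (π x) (ρ y) := rfl

end RepTensor

section AlgTensor

variable {P Q P' Q' : Type u} [Ring P] [Algebra ℂ P] [StarRing P] [StarModule ℂ P]
  [Ring Q] [Algebra ℂ Q] [StarRing Q] [StarModule ℂ Q]
  [Ring P'] [Algebra ℂ P'] [StarRing P'] [StarModule ℂ P']
  [Ring Q'] [Algebra ℂ Q'] [StarRing Q'] [StarModule ℂ Q']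

/-- The algebraic tensor product of two `*`-homomorphisms. -/
def algTensorMap (f : P →⋆ₐ[ℂ] P') (g : Q →⋆ₐ[ℂ] Q') : (P ⊗[ℂ] Q) →⋆ₐ[ℂ] (P' ⊗[ℂ] Q') :=
  { Algebra.TensorProduct.map f.toAlgHom g.toAlgHom with
    map_star' := fun z => by
      change Algebra.TensorProduct.map f.toAlgHom g.toAlgHom (star z) =
        star (Algebra.TensorProduct.map f.toAlgHom g.toAlgHom z)
      induction z with
      | zero => simp
      | add a b ha hb => rw [star_add, map_add, map_add, star_add, ha, hb]
      | tmul a b =>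
        rw [TensorProduct.star_tmul, Algebra.TensorProduct.map_tmul,
          Algebra.TensorProduct.map_tmul, TensorProduct.star_tmul]
        exact congrArg₂ (fun x y => x ⊗ₜ[ℂ] y) (map_star f a) (map_star g b) }

@[simp] lemma algTensorMap_tmul (f : P →⋆ₐ[ℂ] P') (g : Q →⋆ₐ[ℂ] Q') (x : P) (y : Q) :
    algTensorMap f g (x ⊗ₜ y) = f x ⊗ₜ g y := rfl

variable (P Q)

/-- The `*`-homomorphism `x ↦ x ⊗ 1`. -/
def algInclLeft : P →⋆ₐ[ℂ] (P ⊗[ℂ] Q) :=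
  { (Algebra.TensorProduct.includeLeft : P →ₐ[ℂ] P ⊗[ℂ] Q) with
    map_star' := fun x => by
      change star x ⊗ₜ[ℂ] (1 : Q) = star (x ⊗ₜ[ℂ] (1 : Q))
      rw [TensorProduct.star_tmul, star_one] }

/-- The `*`-homomorphism `y ↦ 1 ⊗ y`. -/
def algInclRight : Q →⋆ₐ[ℂ] (P ⊗[ℂ] Q) :=
  { (Algebra.TensorProduct.includeRight : Q →ₐ[ℂ] P ⊗[ℂ] Q) with
    map_star' := fun x => by
      change (1 : P) ⊗ₜ[ℂ] star x = star ((1 : P) ⊗ₜ[ℂ] x)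
      rw [TensorProduct.star_tmul, star_one] }

@[simp] lemma algInclLeft_apply (x : P) : algInclLeft P Q x = x ⊗ₜ 1 := rfl
@[simp] lemma algInclRight_apply (y : Q) : algInclRight P Q y = 1 ⊗ₜ y := rfl

end AlgTensor

/-- A pair of (unital) `*`-representations of `A` and `B` on Hilbert spaces. -/
structure RepPair (A B : Type u) [CStarAlgebra A] [CStarAlgebra B] : Type (u + 1) where
  (H K : Type u)
  [normedH : NormedAddCommGroup H] [innerH : InnerProductSpace ℂ H] [completeH : CompleteSpace H]
  [normedK : NormedAddCommGroup K] [innerK : InnerProductSpace ℂ K] [completeK : CompleteSpace K]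
  π : A →⋆ₐ[ℂ] (H →L[ℂ] H)
  ρ : B →⋆ₐ[ℂ] (K →L[ℂ] K)

/-- A triple of (unital) `*`-representations of `A`, `B` and `C` on Hilbert spaces. -/
structure RepTriple (A B C : Type u) [CStarAlgebra A] [CStarAlgebra B] [CStarAlgebra C] :
    Type (u + 1) where
  (H K L : Type u)
  [normedH : NormedAddCommGroup H] [innerH : InnerProductSpace ℂ H] [completeH : CompleteSpace H]
  [normedK : NormedAddCommGroup K] [innerK : InnerProductSpace ℂ K] [completeK : CompleteSpace K]
  [normedL : NormedAddCommGroup L] [innerL : InnerProductSpace ℂ L] [completeL : CompleteSpace L]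
  π : A →⋆ₐ[ℂ] (H →L[ℂ] H)
  ρ : B →⋆ₐ[ℂ] (K →L[ℂ] K)
  τ : C →⋆ₐ[ℂ] (L →L[ℂ] L)

attribute [instance] RepPair.normedH RepPair.innerH RepPair.completeH RepPair.normedK
  RepPair.innerK RepPair.completeK RepTriple.normedH RepTriple.innerH RepTriple.completeH
  RepTriple.normedK RepTriple.innerK RepTriple.completeK RepTriple.normedL RepTriple.innerL
  RepTriple.completeL

lemma starAlgHom_continuous {A B : Type*} [CStarAlgebra A] [CStarAlgebra B] (f : A →⋆ₐ[ℂ] B) :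
    Continuous f :=
  AddMonoidHomClass.continuous_of_bound f 1 fun x => by
    rw [one_mul]; exact NonUnitalStarAlgHom.norm_apply_le f x

lemma CStarSeminorm.hom_ext {P : Type u} [Ring P] [Algebra ℂ P] [StarRing P] [StarModule ℂ P]
    {p : CStarSeminorm P} {D : Type w} [CStarAlgebra D] {f g : p.Completion →⋆ₐ[ℂ] D}
    (h : ∀ x, f (p.coe x) = g (p.coe x)) : f = g :=
  StarAlgHom.ext (p.ind (isClosed_eq (starAlgHom_continuous f) (starAlgHom_continuous g)) h)

section Spatial

variable (A B C : Type u) [CStarAlgebra A] [CStarAlgebra B] [CStarAlgebra C]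

lemma norm_rep_le {A : Type u} [CStarAlgebra A] {H : Type v} [NormedAddCommGroup H]
    [InnerProductSpace ℂ H] [CompleteSpace H] (π : A →⋆ₐ[ℂ] (H →L[ℂ] H)) (a : A) :
    ‖π a‖ ≤ ‖a‖ := NonUnitalStarAlgHom.norm_apply_le π a

variable {A B} in
lemma exists_bound_pair (x : A ⊗[ℂ] B) :
    ∃ c, ∀ r : RepPair A B, ‖repTensor r.π r.ρ x‖ ≤ c := by
  induction x with
  | zero => exact ⟨0, fun r => by rw [map_zero, norm_zero]⟩
  | add a b ha hb =>
    obtain ⟨c, hc⟩ := ha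
    obtain ⟨d, hd⟩ := hb
    exact ⟨c + d, fun r => by
      rw [map_add]; exact (norm_add_le _ _).trans (add_le_add (hc r) (hd r))⟩
  | tmul a b =>
    exact ⟨‖a‖ * ‖b‖, fun r => (norm_opTensor_le _ _).trans
      (mul_le_mul (norm_rep_le _ _) (norm_rep_le _ _) (norm_nonneg _) (norm_nonneg _))⟩

/-- The spatial C*-seminorm on the algebraic tensor product: the supremum of
`‖(π ⊗ ρ) x‖` over all representations `π` of `A` and `ρ` of `B`. -/
def spatialSeminorm : CStarSeminorm (A ⊗[ℂ] B) :=
  CStarSeminorm.ofFamily (fun r : RepPair A B => repTensor r.π r.ρ) fun x => by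
    obtain ⟨c, hc⟩ := exists_bound_pair x
    exact ⟨c, by rintro _ ⟨r, rfl⟩; exact hc r⟩

/-- The minimal (spatial) tensor product of two C*-algebras. -/
def SpatialTensor : Type u := (spatialSeminorm A B).Completion

instance : CStarAlgebra (SpatialTensor A B) :=
  inferInstanceAs (CStarAlgebra (spatialSeminorm A B).Completion)

variable {A B C} in
lemma exists_bound_triple (x : (A ⊗[ℂ] B) ⊗[ℂ] C) :
    ∃ c, ∀ r : RepTriple A B C, ‖repTensor (repTensor r.π r.ρ) r.τ x‖ ≤ c := by
  induction x with
  | zero => exact ⟨0, fun r => by rw [map_zero, norm_zero]⟩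
  | add a b ha hb =>
    obtain ⟨c, hc⟩ := ha
    obtain ⟨d, hd⟩ := hb
    exact ⟨c + d, fun r => by
      rw [map_add]; exact (norm_add_le _ _).trans (add_le_add (hc r) (hd r))⟩
  | tmul a b =>
    obtain ⟨c, hc⟩ := exists_bound_pair a
    exact ⟨c * ‖b‖, fun r => (norm_opTensor_le _ _).trans
      (mul_le_mul (hc ⟨r.H, r.K, r.π, r.ρ⟩) (norm_rep_le _ _) (norm_nonneg _)
        ((norm_nonneg _).trans (hc ⟨r.H, r.K, r.π, r.ρ⟩)))⟩

/-- The spatial C*-seminorm on the algebraic tensor product of three C*-algebras. -/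
def spatialSeminorm₃ : CStarSeminorm ((A ⊗[ℂ] B) ⊗[ℂ] C) :=
  CStarSeminorm.ofFamily (fun r : RepTriple A B C => repTensor (repTensor r.π r.ρ) r.τ)
    fun x => by
      obtain ⟨c, hc⟩ := exists_bound_triple x
      exact ⟨c, by rintro _ ⟨r, rfl⟩; exact hc r⟩

/-- The minimal (spatial) tensor product of three C*-algebras. -/
def SpatialTensor₃ : Type u := (spatialSeminorm₃ A B C).Completion

instance : CStarAlgebra (SpatialTensor₃ A B C) :=
  inferInstanceAs (CStarAlgebra (spatialSeminorm₃ A B C).Completion)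

end Spatial

namespace SpatialTensor

variable {A B C A' B' C' : Type u} [CStarAlgebra A] [CStarAlgebra B] [CStarAlgebra C]
  [CStarAlgebra A'] [CStarAlgebra B'] [CStarAlgebra C']

variable (A B C) in
/-- The canonical map of the algebraic tensor product to the minimal tensor product. -/
def coeHom : (A ⊗[ℂ] B) →⋆ₐ[ℂ] SpatialTensor A B := (spatialSeminorm A B).coeHom

variable (A B C) in
/-- The canonical map of the algebraic tensor product to the minimal tensor product. -/
def coeHom₃ : ((A ⊗[ℂ] B) ⊗[ℂ] C) →⋆ₐ[ℂ] SpatialTensor₃ A B C := (spatialSeminorm₃ A B C).coeHom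

lemma norm_coeHom (x : A ⊗[ℂ] B) : ‖coeHom A B x‖ = (spatialSeminorm A B).toFun x :=
  (spatialSeminorm A B).norm_coe x

lemma norm_coeHom₃ (x : (A ⊗[ℂ] B) ⊗[ℂ] C) :
    ‖coeHom₃ A B C x‖ = (spatialSeminorm₃ A B C).toFun x :=
  (spatialSeminorm₃ A B C).norm_coe x

/-- A `*`-homomorphism dominated by the spatial seminorm extends to the minimal tensor product. -/
def lift {D : Type w} [CStarAlgebra D] (φ : (A ⊗[ℂ] B) →⋆ₐ[ℂ] D)
    (h : ∀ x, ‖φ x‖ ≤ (spatialSeminorm A B).toFun x) : SpatialTensor A B →⋆ₐ[ℂ] D :=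
  (spatialSeminorm A B).lift φ h

lemma lift_coeHom {D : Type w} [CStarAlgebra D] (φ : (A ⊗[ℂ] B) →⋆ₐ[ℂ] D)
    (h : ∀ x, ‖φ x‖ ≤ (spatialSeminorm A B).toFun x) (x : A ⊗[ℂ] B) :
    lift φ h (coeHom A B x) = φ x := (spatialSeminorm A B).lift_coe φ h x

/-- A `*`-homomorphism dominated by the spatial seminorm extends to the minimal tensor product. -/
def lift₃ {D : Type w} [CStarAlgebra D] (φ : ((A ⊗[ℂ] B) ⊗[ℂ] C) →⋆ₐ[ℂ] D)
    (h : ∀ x, ‖φ x‖ ≤ (spatialSeminorm₃ A B C).toFun x) : SpatialTensor₃ A B C →⋆ₐ[ℂ] D :=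
  (spatialSeminorm₃ A B C).lift φ h

lemma lift₃_coeHom {D : Type w} [CStarAlgebra D] (φ : ((A ⊗[ℂ] B) ⊗[ℂ] C) →⋆ₐ[ℂ] D)
    (h : ∀ x, ‖φ x‖ ≤ (spatialSeminorm₃ A B C).toFun x) (x : (A ⊗[ℂ] B) ⊗[ℂ] C) :
    lift₃ φ h (coeHom₃ A B C x) = φ x := (spatialSeminorm₃ A B C).lift_coe φ h x

lemma hom_ext {D : Type w} [CStarAlgebra D] {f g : SpatialTensor A B →⋆ₐ[ℂ] D}
    (h : ∀ x, f (coeHom A B x) = g (coeHom A B x)) : f = g :=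
  CStarSeminorm.hom_ext (p := spatialSeminorm A B) h

/-- The elementary tensor `a ⊗ b`. -/
def tmul (a : A) (b : B) : SpatialTensor A B := coeHom A B (a ⊗ₜ b)

lemma norm_map_le (f : A →⋆ₐ[ℂ] A') (g : B →⋆ₐ[ℂ] B') (x : A ⊗[ℂ] B) :
    (spatialSeminorm A' B').toFun (algTensorMap f g x) ≤ (spatialSeminorm A B).toFun x := by
  refine CStarSeminorm.ofFamily_le _ _ _ (apply_nonneg (spatialSeminorm A B).toSeminorm x)
    fun r => ?_
  have h : repTensor r.π r.ρ (algTensorMap f g x) = repTensor (r.π.comp f) (r.ρ.comp g) x := by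
    induction x with
    | zero => simp only [map_zero]
    | add a b ha hb => simp only [map_add, ha, hb]
    | tmul a b => rfl
  rw [h]
  exact CStarSeminorm.le_ofFamily (fun r : RepPair A B => repTensor r.π r.ρ) _
    ⟨r.H, r.K, r.π.comp f, r.ρ.comp g⟩ x

/-- The tensor product `f ⊗ g` of `*`-homomorphisms, determined by
`(f ⊗ g) (a ⊗ b) = f a ⊗ g b`. -/
def map (f : A →⋆ₐ[ℂ] A') (g : B →⋆ₐ[ℂ] B') : SpatialTensor A B →⋆ₐ[ℂ] SpatialTensor A' B' :=
  lift ((coeHom A' B').comp (algTensorMap f g)) fun x =>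
    (norm_coeHom _).trans_le (norm_map_le f g x)

@[simp] lemma map_tmul (f : A →⋆ₐ[ℂ] A') (g : B →⋆ₐ[ℂ] B') (a : A) (b : B) :
    map f g (tmul a b) = tmul (f a) (g b) :=
  lift_coeHom _ _ _

lemma norm_map₃_le (f : A →⋆ₐ[ℂ] A') (g : B →⋆ₐ[ℂ] B') (h : C →⋆ₐ[ℂ] C')
    (x : (A ⊗[ℂ] B) ⊗[ℂ] C) :
    (spatialSeminorm₃ A' B' C').toFun (algTensorMap (algTensorMap f g) h x) ≤
      (spatialSeminorm₃ A B C).toFun x := by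
  refine CStarSeminorm.ofFamily_le _ _ _ (apply_nonneg (spatialSeminorm₃ A B C).toSeminorm x)
    fun r => ?_
  have h1 : ∀ y : A ⊗[ℂ] B,
      repTensor r.π r.ρ (algTensorMap f g y) = repTensor (r.π.comp f) (r.ρ.comp g) y := fun y => by
    induction y with
    | zero => simp only [map_zero]
    | add a b ha hb => simp only [map_add, ha, hb]
    | tmul a b => rfl
  have h2 : repTensor (repTensor r.π r.ρ) r.τ (algTensorMap (algTensorMap f g) h x) =
      repTensor (repTensor (r.π.comp f) (r.ρ.comp g)) (r.τ.comp h) x := by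
    induction x with
    | zero => simp only [map_zero]
    | add a b ha hb => simp only [map_add, ha, hb]
    | tmul a b => rw [algTensorMap_tmul, repTensor_tmul, repTensor_tmul, h1]; rfl
  rw [h2]
  exact CStarSeminorm.le_ofFamily
    (fun r : RepTriple A B C => repTensor (repTensor r.π r.ρ) r.τ) _
    ⟨r.H, r.K, r.L, r.π.comp f, r.ρ.comp g, r.τ.comp h⟩ x

/-- The tensor product `f ⊗ g ⊗ h` of three `*`-homomorphisms. -/
def map₃ (f : A →⋆ₐ[ℂ] A') (g : B →⋆ₐ[ℂ] B') (h : C →⋆ₐ[ℂ] C') :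
    SpatialTensor₃ A B C →⋆ₐ[ℂ] SpatialTensor₃ A' B' C' :=
  lift₃ ((coeHom₃ A' B' C').comp (algTensorMap (algTensorMap f g) h)) fun x =>
    (norm_coeHom₃ _).trans_le (norm_map₃_le f g h x)

variable (A B C)

/-- The embedding `a ↦ a ⊗ 1` of `A` into `A ⊗ B`. -/
def inclLeft : A →⋆ₐ[ℂ] SpatialTensor A B := (coeHom A B).comp (algInclLeft A B)

/-- The embedding `b ↦ 1 ⊗ b` of `B` into `A ⊗ B`. -/
def inclRight : B →⋆ₐ[ℂ] SpatialTensor A B := (coeHom A B).comp (algInclRight A B)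

/-- The embedding `a ↦ a ⊗ 1 ⊗ 1` of `A` into `A ⊗ B ⊗ C`. -/
def leg₁ : A →⋆ₐ[ℂ] SpatialTensor₃ A B C :=
  (coeHom₃ A B C).comp ((algInclLeft (A ⊗[ℂ] B) C).comp (algInclLeft A B))

/-- The embedding `c ↦ 1 ⊗ 1 ⊗ c` of `C` into `A ⊗ B ⊗ C`. -/
def leg₃ : C →⋆ₐ[ℂ] SpatialTensor₃ A B C :=
  (coeHom₃ A B C).comp (algInclRight (A ⊗[ℂ] B) C)

/-- The embedding `x ↦ x ⊗ 1` of `A ⊗ B` into `A ⊗ B ⊗ C`. -/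
def leg₁₂ : SpatialTensor A B →⋆ₐ[ℂ] SpatialTensor₃ A B C :=
  lift
    ((coeHom₃ A B C).comp (algInclLeft (A ⊗[ℂ] B) C)) fun x => by
      refine (norm_coeHom₃ _).trans_le (CStarSeminorm.ofFamily_le _ _ _
        (apply_nonneg (spatialSeminorm A B).toSeminorm x) fun r => ?_)
      change ‖opTensor (repTensor r.π r.ρ x) (r.τ 1)‖ ≤ _
      rw [map_one]
      refine (norm_opTensor_le _ _).trans ((mul_le_of_le_one_right (norm_nonneg _)
        ContinuousLinearMap.norm_id_le).trans ?_)
      exact CStarSeminorm.le_ofFamily (fun r : RepPair A B => repTensor r.π r.ρ) _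
        ⟨r.H, r.K, r.π, r.ρ⟩ x

/-- The embedding `y ↦ 1 ⊗ y` of `B ⊗ C` into `A ⊗ B ⊗ C`. -/
def leg₂₃ : SpatialTensor B C →⋆ₐ[ℂ] SpatialTensor₃ A B C :=
  lift
    ((coeHom₃ A B C).comp
      (algTensorMap (algInclRight A B) (StarAlgHom.id ℂ C))) fun x => by
      refine (norm_coeHom₃ _).trans_le (CStarSeminorm.ofFamily_le _ _ _
        (apply_nonneg (spatialSeminorm B C).toSeminorm x) fun r => ?_)
      have h : repTensor (repTensor r.π r.ρ) r.τ
          (algTensorMap (algInclRight A B) (StarAlgHom.id ℂ C) x) =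
          repTensor ((repTensor r.π r.ρ).comp (algInclRight A B)) r.τ x := by
        induction x with
        | zero => simp only [map_zero]
        | add a b ha hb => simp only [map_add, ha, hb]
        | tmul a b => rfl
      refine (congrArg norm h).trans_le ?_
      exact CStarSeminorm.le_ofFamily (fun r : RepPair B C => repTensor r.π r.ρ) _
        ⟨HilbertTensor r.H r.K, r.L, (repTensor r.π r.ρ).comp (algInclRight A B), r.τ⟩ x

end SpatialTensor

namespace SpatialTensor

variable {A B C A' B' C' : Type u} [CStarAlgebra A] [CStarAlgebra B] [CStarAlgebra C]
  [CStarAlgebra A'] [CStarAlgebra B'] [CStarAlgebra C']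
  (f : A →⋆ₐ[ℂ] A') (g : B →⋆ₐ[ℂ] B') (h : C →⋆ₐ[ℂ] C')

lemma map_coe (x : A ⊗[ℂ] B) : map f g (coeHom A B x) =
    coeHom A' B' (algTensorMap f g x) :=
  lift_coeHom _ _ _

lemma map₃_coe (x : (A ⊗[ℂ] B) ⊗[ℂ] C) : map₃ f g h (coeHom₃ A B C x) =
    coeHom₃ A' B' C' (algTensorMap (algTensorMap f g) h x) :=
  lift₃_coeHom _ _ _

lemma leg₁₂_coe (x : A ⊗[ℂ] B) : leg₁₂ A B C (coeHom A B x) =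
    coeHom₃ A B C (x ⊗ₜ 1) :=
  lift_coeHom _ _ _

lemma leg₂₃_coe (x : B ⊗[ℂ] C) : leg₂₃ A B C (coeHom B C x) =
    coeHom₃ A B C (algTensorMap (algInclRight A B) (StarAlgHom.id ℂ C) x) :=
  lift_coeHom _ _ _

lemma map_inclLeft (a : A) : map f g (inclLeft A B a) = inclLeft A' B' (f a) :=
  (map_tmul f g a 1).trans (by rw [map_one]; rfl)

lemma map_inclRight (b : B) : map f g (inclRight A B b) = inclRight A' B' (g b) :=
  (map_tmul f g 1 b).trans (by rw [map_one]; rfl)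

lemma map_leg₁ (a : A) : map₃ f g h (leg₁ A B C a) = leg₁ A' B' C' (f a) := by
  refine (map₃_coe f g h ((a ⊗ₜ 1) ⊗ₜ 1)).trans ?_
  rw [algTensorMap_tmul, algTensorMap_tmul, map_one, map_one]
  rfl

lemma map_leg₃ (c : C) : map₃ f g h (leg₃ A B C c) = leg₃ A' B' C' (h c) := by
  refine (map₃_coe f g h (1 ⊗ₜ c)).trans ?_
  rw [algTensorMap_tmul, map_one]
  rfl

lemma map_leg₁₂ : (map₃ f g h).comp (leg₁₂ A B C) = (leg₁₂ A' B' C').comp (map f g) :=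
  hom_ext fun x => by
    rw [StarAlgHom.comp_apply, StarAlgHom.comp_apply, leg₁₂_coe, map_coe, map₃_coe, leg₁₂_coe,
      algTensorMap_tmul, map_one]

lemma map_leg₂₃ : (map₃ f g h).comp (leg₂₃ A B C) = (leg₂₃ A' B' C').comp (map g h) :=
  hom_ext fun x => by
    rw [StarAlgHom.comp_apply, StarAlgHom.comp_apply, leg₂₃_coe, map_coe, map₃_coe, leg₂₃_coe]
    congr 1
    induction x with
    | zero => simp only [map_zero]
    | add a b ha hb => simp only [map_add, ha, hb]
    | tmul a b =>
      simp only [algTensorMap_tmul, algInclRight_apply, map_one]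
      rfl

end SpatialTensor

/-! ### `σ`-C*-algebras and `σ`-C*-quantum groups -/

/-- A sequential inverse system of unital C*-algebras and unital `*`-homomorphisms. -/
structure CStarInverseSystem (A : ℕ → Type u) [∀ n, CStarAlgebra (A n)] : Type u where
  /-- The connecting homomorphisms. -/
  map : ∀ n, A (n + 1) →⋆ₐ[ℂ] A n

namespace CStarInverseSystem

variable {A B C : ℕ → Type u} [∀ n, CStarAlgebra (A n)] [∀ n, CStarAlgebra (B n)]
  [∀ n, CStarAlgebra (C n)]

/-- The connecting homomorphisms are surjective. -/
def IsSurjective (S : CStarInverseSystem A) : Prop := ∀ n, Function.Surjective (S.map n)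

/-- The inverse limit of the system in the category of topological `*`-algebras: the `*`-algebra of
all compatible sequences (bounded or not), with the topology of the product. -/
def lim (S : CStarInverseSystem A) : StarSubalgebra ℂ (∀ n, A n) where
  carrier := {a | ∀ n, S.map n (a (n + 1)) = a n}
  mul_mem' ha hb n := by rw [Pi.mul_apply, Pi.mul_apply, map_mul, ha n, hb n]
  one_mem' n := map_one (S.map n)
  add_mem' ha hb n := by rw [Pi.add_apply, Pi.add_apply, map_add, ha n, hb n]
  zero_mem' n := map_zero (S.map n)
  algebraMap_mem' c n := by
    rw [Pi.algebraMap_apply, Pi.algebraMap_apply]; exact AlgHomClass.commutes (S.map n) c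
  star_mem' ha n := by rw [Pi.star_apply, Pi.star_apply, map_star, ha n]

/-- The homomorphism of inverse limits induced by a morphism of inverse systems. -/
def limMap {S : CStarInverseSystem A} {T : CStarInverseSystem B} (f : ∀ n, A n →⋆ₐ[ℂ] B n)
    (hf : ∀ n, (T.map n).comp (f (n + 1)) = (f n).comp (S.map n)) : S.lim →⋆ₐ[ℂ] T.lim where
  toFun a := ⟨fun n => f n (a.1 n), fun n =>
    (DFunLike.congr_fun (hf n) (a.1 (n + 1))).trans (congrArg (f n) (a.2 n))⟩
  map_one' := Subtype.ext (funext fun n => map_one (f n))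
  map_mul' a b := Subtype.ext (funext fun n => map_mul (f n) (a.1 n) (b.1 n))
  map_zero' := Subtype.ext (funext fun n => map_zero (f n))
  map_add' a b := Subtype.ext (funext fun n => map_add (f n) (a.1 n) (b.1 n))
  commutes' c := Subtype.ext (funext fun n => AlgHomClass.commutes (f n) c)
  map_star' a := Subtype.ext (funext fun n => map_star (f n) (a.1 n))

/-- The system of minimal tensor products; its limit is by definition the minimal tensor product
of the limits of `S` and `T`. -/
def tensor (S : CStarInverseSystem A) (T : CStarInverseSystem B) :
    CStarInverseSystem (fun n => SpatialTensor (A n) (B n)) where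
  map n := SpatialTensor.map (S.map n) (T.map n)

/-- The system of threefold minimal tensor products. -/
def tensor₃ (S : CStarInverseSystem A) (T : CStarInverseSystem B) (U : CStarInverseSystem C) :
    CStarInverseSystem (fun n => SpatialTensor₃ (A n) (B n) (C n)) where
  map n := SpatialTensor.map₃ (S.map n) (T.map n) (U.map n)

variable (S : CStarInverseSystem A) (T : CStarInverseSystem B) (U : CStarInverseSystem C)

/-- `a ↦ a ⊗ 1` -/
def inclLeft : S.lim →⋆ₐ[ℂ] (S.tensor T).lim :=
  limMap (fun n => SpatialTensor.inclLeft (A n) (B n)) fun n => StarAlgHom.ext fun a =>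
    SpatialTensor.map_inclLeft (S.map n) (T.map n) a

/-- `b ↦ 1 ⊗ b` -/
def inclRight : T.lim →⋆ₐ[ℂ] (S.tensor T).lim :=
  limMap (fun n => SpatialTensor.inclRight (A n) (B n)) fun n => StarAlgHom.ext fun b =>
    SpatialTensor.map_inclRight (S.map n) (T.map n) b

/-- `a ↦ a ⊗ 1 ⊗ 1` -/
def leg₁ : S.lim →⋆ₐ[ℂ] (S.tensor₃ T U).lim :=
  limMap (fun n => SpatialTensor.leg₁ (A n) (B n) (C n)) fun n =>
    StarAlgHom.ext fun a => SpatialTensor.map_leg₁ (S.map n) (T.map n) (U.map n) a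

/-- `c ↦ 1 ⊗ 1 ⊗ c` -/
def leg₃ : U.lim →⋆ₐ[ℂ] (S.tensor₃ T U).lim :=
  limMap (fun n => SpatialTensor.leg₃ (A n) (B n) (C n)) fun n =>
    StarAlgHom.ext fun c => SpatialTensor.map_leg₃ (S.map n) (T.map n) (U.map n) c

/-- `x ↦ x ⊗ 1` -/
def leg₁₂ : (S.tensor T).lim →⋆ₐ[ℂ] (S.tensor₃ T U).lim :=
  limMap (S := S.tensor T) (T := S.tensor₃ T U)
    (fun n => SpatialTensor.leg₁₂ (A n) (B n) (C n)) fun n =>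
      SpatialTensor.map_leg₁₂ (S.map n) (T.map n) (U.map n)

/-- `y ↦ 1 ⊗ y` -/
def leg₂₃ : (T.tensor U).lim →⋆ₐ[ℂ] (S.tensor₃ T U).lim :=
  limMap (S := T.tensor U) (T := S.tensor₃ T U)
    (fun n => SpatialTensor.leg₂₃ (A n) (B n) (C n)) fun n =>
      SpatialTensor.map_leg₂₃ (S.map n) (T.map n) (U.map n)

variable {S}

/-- `D` is the homomorphism `Δ ⊗ id : A ⊗ A → A ⊗ A ⊗ A`, i.e. the (unique) continuous
`*`-homomorphism with `D (a ⊗ b) = Δ a ⊗ b`. -/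
structure IsTensorId (Δ : S.lim →⋆ₐ[ℂ] (S.tensor S).lim)
    (D : (S.tensor S).lim →⋆ₐ[ℂ] (S.tensor₃ S S).lim) : Prop where
  continuous : Continuous D
  apply_tmul : ∀ a b : S.lim,
    D (inclLeft S S a * inclRight S S b) = leg₁₂ S S S (Δ a) * leg₃ S S S b

/-- `E` is the homomorphism `id ⊗ Δ : A ⊗ A → A ⊗ A ⊗ A`, i.e. the (unique) continuous
`*`-homomorphism with `E (a ⊗ b) = a ⊗ Δ b`. -/
structure IsIdTensor (Δ : S.lim →⋆ₐ[ℂ] (S.tensor S).lim)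
    (E : (S.tensor S).lim →⋆ₐ[ℂ] (S.tensor₃ S S).lim) : Prop where
  continuous : Continuous E
  apply_tmul : ∀ a b : S.lim,
    E (inclLeft S S a * inclRight S S b) = leg₁ S S S a * leg₂₃ S S S (Δ b)

/-- The unital `σ`-C*-algebra `A = lim S`, presented as the limit of an inverse system with
surjective connecting maps, is a `σ`-C*-quantum group with comultiplication `Δ : A → A ⊗ A`. -/
structure IsQuantumGroup (S : CStarInverseSystem A) (Δ : S.lim →⋆ₐ[ℂ] (S.tensor S).lim) :
    Prop where
  surjective : S.IsSurjective
  continuous : Continuous Δ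
  /-- `(Δ ⊗ id) Δ = (id ⊗ Δ) Δ` -/
  coassoc : ∃ D E : (S.tensor S).lim →⋆ₐ[ℂ] (S.tensor₃ S S).lim,
    IsTensorId Δ D ∧ IsIdTensor Δ E ∧ D.comp Δ = E.comp Δ
  /-- The linear space `Δ(A)(A ⊗ 1)` is dense in `A ⊗ A`. -/
  dense_left : Dense (Submodule.span ℂ
    {x : (S.tensor S).lim | ∃ a b : S.lim, x = Δ a * inclLeft S S b} : Set (S.tensor S).lim)
  /-- The linear space `Δ(A)(1 ⊗ A)` is dense in `A ⊗ A`. -/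
  dense_right : Dense (Submodule.span ℂ
    {x : (S.tensor S).lim | ∃ a b : S.lim, x = Δ a * inclRight S S b} : Set (S.tensor S).lim)

end CStarInverseSystem

/-! ### The free unital `*`-algebra -/

/-- The free complex unital `*`-algebra on `X`: noncommutative polynomials in the variables
`x` (`Sum.inl x`) and `x^*` (`Sum.inr x`), `x ∈ X`. -/
def FreeStarAlgebra (X : Type) : Type := FreeAlgebra ℂ (X ⊕ X)

namespace FreeStarAlgebra

variable {X : Type}

instance : Ring (FreeStarAlgebra X) := inferInstanceAs (Ring (FreeAlgebra ℂ (X ⊕ X)))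
instance : Algebra ℂ (FreeStarAlgebra X) := inferInstanceAs (Algebra ℂ (FreeAlgebra ℂ (X ⊕ X)))

/-- The variables `x` and `x^*`. -/
def var (s : X ⊕ X) : FreeStarAlgebra X := FreeAlgebra.ι ℂ s

/-- The free algebra's opposite, with scalars acting through complex conjugation. -/
@[reducible] def conjAlgebra (X : Type) : Algebra ℂ (FreeStarAlgebra X)ᵐᵒᵖ :=
  RingHom.toAlgebra' ((algebraMap ℂ (FreeStarAlgebra X)ᵐᵒᵖ).comp (starRingEnd ℂ))
    fun c x => Algebra.commutes (R := ℂ) (starRingEnd ℂ c) x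

/-- The involution, as a ring homomorphism to the opposite ring. -/
def starHom (X : Type) : FreeStarAlgebra X →+* (FreeStarAlgebra X)ᵐᵒᵖ :=
  letI := conjAlgebra X
  (FreeAlgebra.lift ℂ (fun s : X ⊕ X => MulOpposite.op (var s.swap))).toRingHom

lemma starHom_var (s : X ⊕ X) : starHom X (var s) = MulOpposite.op (var s.swap) :=
  letI := conjAlgebra X
  FreeAlgebra.lift_ι_apply (R := ℂ) (fun s : X ⊕ X => MulOpposite.op (var s.swap)) s

lemma starHom_algebraMap (c : ℂ) :
    starHom X (algebraMap ℂ (FreeStarAlgebra X) c) =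
      MulOpposite.op (algebraMap ℂ (FreeStarAlgebra X) (starRingEnd ℂ c)) :=
  letI := conjAlgebra X
  (FreeAlgebra.lift ℂ (fun s : X ⊕ X => MulOpposite.op (var s.swap))).commutes c

@[elab_as_elim]
lemma ind {motive : FreeStarAlgebra X → Prop}
    (h0 : ∀ c : ℂ, motive (algebraMap ℂ (FreeStarAlgebra X) c)) (h1 : ∀ s, motive (var s))
    (hm : ∀ a b, motive a → motive b → motive (a * b))
    (ha : ∀ a b, motive a → motive b → motive (a + b)) (x : FreeStarAlgebra X) : motive x :=
  FreeAlgebra.induction ℂ (X ⊕ X) (motive := motive) h0 h1 hm ha x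

/-- The conjugate-linear antimultiplicative involution exchanging `x` and `x^*`. -/
instance : StarRing (FreeStarAlgebra X) where
  star x := (starHom X x).unop
  star_involutive x := by
    change (starHom X (starHom X x).unop).unop = x
    induction x using ind with
    | h0 c => rw [starHom_algebraMap, MulOpposite.unop_op, starHom_algebraMap,
        MulOpposite.unop_op, Complex.conj_conj]
    | h1 s => rw [starHom_var, MulOpposite.unop_op, starHom_var, MulOpposite.unop_op,
        Sum.swap_swap]
    | hm a b ha hb => rw [map_mul, MulOpposite.unop_mul, map_mul, MulOpposite.unop_mul, ha, hb]
    | ha a b ha hb => rw [map_add, MulOpposite.unop_add, map_add, MulOpposite.unop_add, ha, hb]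
  star_mul a b := by
    change (starHom X (a * b)).unop = _
    rw [map_mul, MulOpposite.unop_mul]
  star_add a b := by
    change (starHom X (a + b)).unop = _
    rw [map_add, MulOpposite.unop_add]

lemma star_var (s : X ⊕ X) : star (var s) = var s.swap :=
  congrArg MulOpposite.unop (starHom_var s)

lemma star_algebraMap (c : ℂ) : star (algebraMap ℂ (FreeStarAlgebra X) c) =
    algebraMap ℂ (FreeStarAlgebra X) (star c) :=
  congrArg MulOpposite.unop (starHom_algebraMap c)

instance : StarModule ℂ (FreeStarAlgebra X) where
  star_smul c x := by
    rw [Algebra.smul_def, star_mul, star_algebraMap, ← Algebra.commutes, ← Algebra.smul_def]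

/-- Evaluation of noncommutative `*`-polynomials at a family of elements of a `*`-algebra. -/
def eval {B : Type w} [Ring B] [Algebra ℂ B] [StarRing B] [StarModule ℂ B] (u : X → B) :
    FreeStarAlgebra X →⋆ₐ[ℂ] B :=
  let φ : FreeStarAlgebra X →ₐ[ℂ] B := FreeAlgebra.lift ℂ (Sum.elim u fun x => star (u x))
  have hφ : ∀ s, φ (var s) = Sum.elim u (fun x => star (u x)) s := fun s =>
    FreeAlgebra.lift_ι_apply _ s
  { φ with
    map_star' := fun x => by
      change φ (star x) = star (φ x)
      induction x using ind with
      | h0 c => rw [star_algebraMap, AlgHom.commutes, AlgHom.commutes, algebraMap_star_comm]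
      | h1 s =>
        rw [star_var, hφ, hφ]
        cases s with
        | inl x => rfl
        | inr x => exact (star_star (u x)).symm
      | hm a b ha hb => rw [star_mul, map_mul, map_mul, star_mul, ha, hb]
      | ha a b ha hb => rw [star_add, map_add, map_add, star_add, ha, hb] }

lemma eval_var {B : Type w} [Ring B] [Algebra ℂ B] [StarRing B] [StarModule ℂ B] (u : X → B)
    (s : X ⊕ X) : eval u (var s) = Sum.elim u (fun x => star (u x)) s :=
  FreeAlgebra.lift_ι_apply _ s

end FreeStarAlgebra

/-! ### The C*-algebras `C(SU_q(n))` -/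

/-- The number of inversions of `(i_1, …, i_n)`: pairs `a < b` with `i_a > i_b`. -/
def inversions {n : ℕ} (i : Fin n → Fin n) : ℕ :=
  (Finset.univ.filter fun p : Fin n × Fin n => p.1 < p.2 ∧ i p.2 < i p.1).card

open Classical in
/-- `E_{i_1 ⋯ i_n}`: zero if `i_1, …, i_n` are not distinct, `(-q)^ℓ(i_1, …, i_n)` otherwise. -/
def qLeviCivita (q : ℝ) {n : ℕ} (i : Fin n → Fin n) : ℂ :=
  if Function.Injective i then (-(q : ℂ)) ^ inversions i else 0

/-- The defining relations of `C(SU_q(n))` for a matrix `u` of elements of a unital `*`-algebra. -/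
structure IsSUqMatrix (q : ℝ) (n : ℕ) {B : Type w} [Ring B] [Algebra ℂ B] [StarRing B]
    (u : Fin n → Fin n → B) : Prop where
  mul_star : ∀ i j, ∑ k, u i k * star (u j k) = if i = j then 1 else 0
  star_mul : ∀ i j, ∑ k, star (u k i) * u k j = if i = j then 1 else 0
  det : ∀ j : Fin n → Fin n,
    ∑ i : Fin n → Fin n, qLeviCivita q i • (List.ofFn fun k => u (j k) (i k)).prod =
      qLeviCivita q j • (1 : B)

/-- A C*-algebra with a matrix satisfying the defining relations of `C(SU_q(n))`. -/
structure SUqModel (q : ℝ) (n : ℕ) : Type 1 where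
  B : Type
  [cstar : CStarAlgebra B]
  u : Fin n → Fin n → B
  isSUq : IsSUqMatrix q n u

attribute [instance] SUqModel.cstar

/-- Evaluation of `*`-polynomials in the matrix entries in a model. -/
def SUqModel.eval {q : ℝ} {n : ℕ} (M : SUqModel q n) :
    FreeStarAlgebra (Fin n × Fin n) →⋆ₐ[ℂ] M.B :=
  FreeStarAlgebra.eval fun x => M.u x.1 x.2

lemma SUqModel.norm_one_le {q : ℝ} {n : ℕ} (M : SUqModel q n) : ‖(1 : M.B)‖ ≤ 1 := by
  by_contra! h
  have := CStarRing.norm_star_mul_self (x := (1 : M.B))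
  rw [star_one, one_mul] at this
  nlinarith

lemma SUqModel.norm_u_le {q : ℝ} {n : ℕ} (M : SUqModel q n) (i j : Fin n) : ‖M.u i j‖ ≤ 1 := by
  let _ := CStarAlgebra.spectralOrder M.B
  have := CStarAlgebra.spectralOrderedRing M.B
  have h1 : star (M.u i j) * M.u i j ≤ ∑ k, star (M.u k j) * M.u k j :=
    Finset.single_le_sum (f := fun k => star (M.u k j) * M.u k j)
      (fun k _ => star_mul_self_nonneg _) (Finset.mem_univ i)
  rw [M.isSUq.star_mul, if_pos rfl] at h1
  have h2 := CStarAlgebra.norm_le_norm_of_nonneg_of_le (star_mul_self_nonneg _) h1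
  rw [CStarRing.norm_star_mul_self] at h2
  nlinarith [M.norm_one_le, norm_nonneg (M.u i j)]

lemma SUqModel.exists_bound (q : ℝ) (n : ℕ) (x : FreeStarAlgebra (Fin n × Fin n)) :
    ∃ c, ∀ M : SUqModel q n, ‖M.eval x‖ ≤ c := by
  induction x using FreeStarAlgebra.ind with
  | h0 c =>
    refine ⟨‖c‖, fun M => ?_⟩
    rw [Algebra.algebraMap_eq_smul_one, map_smul, map_one, norm_smul]
    exact mul_le_of_le_one_right (norm_nonneg c) M.norm_one_le
  | h1 s =>
    refine ⟨1, fun M => ?_⟩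
    rw [SUqModel.eval, FreeStarAlgebra.eval_var]
    cases s with
    | inl x => exact M.norm_u_le x.1 x.2
    | inr x => exact (norm_star (M.u x.1 x.2)).trans_le (M.norm_u_le x.1 x.2)
  | hm a b ha hb =>
    obtain ⟨c, hc⟩ := ha
    obtain ⟨d, hd⟩ := hb
    exact ⟨c * d, fun M => by
      rw [map_mul]
      exact (norm_mul_le _ _).trans (mul_le_mul (hc M) (hd M) (norm_nonneg _)
        ((norm_nonneg _).trans (hc M)))⟩
  | ha a b ha hb =>
    obtain ⟨c, hc⟩ := ha
    obtain ⟨d, hd⟩ := hb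
    exact ⟨c + d, fun M => by
      rw [map_add]; exact (norm_add_le _ _).trans (add_le_add (hc M) (hd M))⟩

/-- The universal C*-seminorm: the supremum of the norms over all C*-algebras with a matrix
satisfying the defining relations. -/
def suqSeminorm (q : ℝ) (n : ℕ) : CStarSeminorm (FreeStarAlgebra (Fin n × Fin n)) :=
  CStarSeminorm.ofFamily (fun M : SUqModel q n => M.eval) fun x => by
    obtain ⟨c, hc⟩ := SUqModel.exists_bound q n x
    exact ⟨c, by rintro _ ⟨M, rfl⟩; exact hc M⟩

/-- `C(SU_q(n))`: the universal unital C*-algebra generated by the entries of an `n × n` matrix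
satisfying the defining relations. -/
def CSUq (q : ℝ) (n : ℕ) : Type := (suqSeminorm q n).Completion

instance (q : ℝ) (n : ℕ) : CStarAlgebra (CSUq q n) :=
  inferInstanceAs (CStarAlgebra (suqSeminorm q n).Completion)

/-- The canonical map of the `*`-polynomials in the generators to `C(SU_q(n))`. -/
def CSUq.coeHom (q : ℝ) (n : ℕ) : FreeStarAlgebra (Fin n × Fin n) →⋆ₐ[ℂ] CSUq q n :=
  (suqSeminorm q n).coeHom

/-- The generators `u_{ij}` of `C(SU_q(n))`. -/
def CSUq.u (q : ℝ) (n : ℕ) (i j : Fin n) : CSUq q n :=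
  CSUq.coeHom q n (FreeStarAlgebra.var (Sum.inl (i, j)))

/-- The inverse system `C(SU_q(1)) ← C(SU_q(2)) ← ⋯` with connecting maps `θ`; its limit is
`C(SU_q(∞))`. -/
def suqSystem (q : ℝ) (θ : ∀ n, CSUq q (n + 2) →⋆ₐ[ℂ] CSUq q (n + 1)) :
    CStarInverseSystem (fun n => CSUq q (n + 1)) where
  map := θ

end

/-! The proof works at each finite level and then passes to the limit. By the universal property of
`CSUq`, a homomorphism out of $C(SU_q(n))$ is a matrix satisfying the relations. The block matrix
with blocks $u$ and $1$ satisfies them (`IsSUqMatrix.blockOne`), which gives $\theta$. So does a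
product of two solutions with commuting entries (`IsSUqMatrix.mul`); applied to $u\otimes1$ and
$1\otimes u$ this gives $\Delta$. Compatibility of $\Delta$ with $\theta$ and coassociativity are
then matrix identities on generators.

A Cramer-type argument with the determinant relation expresses $u_{ij}^*$ as a polynomial in the
entries (`IsSUqMatrix.star_mem_adjoin`), so the algebra generated by the entries alone is dense.
Hence $\theta$ has dense range, and is onto because $*$-homomorphisms of C*-algebras have closed
range (`StarAlgHom.surjective_of_denseRange`).

The maps $\Delta\otimes\mathrm{id}$ and $\mathrm{id}\otimes\Delta$ are bounded for the spatial norm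
because a product representation pulled back along them is, up to the Hilbert space associator,
again a product representation. The two density conditions come from unitarity:
$\sum_j\Delta(u_{ij})(1\otimes u_{kj}^*)=u_{ik}\otimes1$ and its mirror image handle generators, and
`dense_span_mul_of_generators` extends this to the whole algebra.

In the limit, coassociativity is checked at each level. Density passes to the limit because
surjective connecting maps make every projection surjective, and the seminorms increase along the
sequence (`CStarInverseSystem.dense_of_dense_proj`). -/

noncomputable section

/-! ### Surjectivity of `*`-homomorphisms with dense range -/

section DenseRange

variable {A : Type u} {B : Type v} [CStarAlgebra A] [CStarAlgebra B]

/-- For `a` not self-adjoint the functional calculus takes its default value zero, and the bound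
still holds. -/
lemma norm_cfc_clamp_le (a : A) {c : ℝ} (hc : 0 ≤ c) :
    ‖cfc (fun t : ℝ => max (-c) (min c t)) a‖ ≤ c :=
  norm_cfc_le hc fun t _ => by
    rw [Real.norm_eq_abs, abs_le]
    exact ⟨le_max_left _ _, max_le (by linarith) (min_le_left _ _)⟩

lemma cfc_clamp_eq_self {b : B} (hb : IsSelfAdjoint b) :
    cfc (fun t : ℝ => max (-‖b‖) (min ‖b‖ t)) b = b := by
  nontriviality B
  conv_rhs => rw [← cfc_id' ℝ b]
  refine cfc_congr fun t ht => ?_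
  have h := abs_le.1 ((Real.norm_eq_abs t).ge.trans (spectrum.norm_le_norm_of_mem ht))
  rw [min_eq_right h.2, max_eq_right h.1]

/-- Truncate `a` at height `‖f a‖` by functional calculus. Since `f` commutes with the calculus, the
image is the truncation of `f a`, which is `f a` itself because its spectrum lies in the truncation
interval. -/
lemma StarAlgHom.exists_lift_norm_le_of_isSelfAdjoint (f : A →⋆ₐ[ℂ] B) {a : A}
    (ha : IsSelfAdjoint a) : ∃ a', f a' = f a ∧ ‖a'‖ ≤ ‖f a‖ := by
  refine ⟨cfc (fun t : ℝ => max (-‖f a‖) (min ‖f a‖ t)) a, ?_,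
    norm_cfc_clamp_le a (norm_nonneg _)⟩
  have hfa : IsSelfAdjoint (f a) := ha.map f
  rw [StarAlgHomClass.map_cfc (S := ℂ) f _ a (by fun_prop) (starAlgHom_continuous f) ha hfa,
    cfc_clamp_eq_self hfa]

/-- Real and imaginary parts are lifted separately, whence the factor 2; any constant independent of
`a` would serve below. -/
lemma StarAlgHom.exists_lift_norm_le (f : A →⋆ₐ[ℂ] B) (a : A) :
    ∃ a', f a' = f a ∧ ‖a'‖ ≤ 2 * ‖f a‖ := by
  obtain ⟨x, hx, hx'⟩ := f.exists_lift_norm_le_of_isSelfAdjoint (realPart a).2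
  obtain ⟨y, hy, hy'⟩ := f.exists_lift_norm_le_of_isSelfAdjoint (imaginaryPart a).2
  have hr : ∀ (r : ℝ) (x : A), f (r • x) = r • f x := fun r x =>
    map_smul (f.restrictScalars ℝ) r x
  have h1 : f (realPart a : A) = (realPart (f a) : B) := by
    simp [realPart_apply_coe, map_star, hr]
  have h2 : f (imaginaryPart a : A) = (imaginaryPart (f a) : B) := by
    simp [imaginaryPart_apply_coe, map_star, hr]
  refine ⟨x + Complex.I • y, ?_, ?_⟩
  · rw [map_add, map_smul, hx, hy, ← map_smul, ← map_add, realPart_add_I_smul_imaginaryPart]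
  · have h3 : ‖x‖ ≤ ‖f a‖ := hx'.trans (by rw [h1]; exact realPart.norm_le (f a))
    have h4 : ‖y‖ ≤ ‖f a‖ := hy'.trans (by rw [h2]; exact imaginaryPart.norm_le (f a))
    calc _ ≤ ‖x‖ + ‖Complex.I • y‖ := norm_add_le _ _
      _ ≤ _ := by rw [norm_smul, Complex.norm_I]; linarith

/-- Norm-controlled lifts on the range allow a point of its closure to be lifted as a convergent
series, by completeness of `A`; so the range is closed. -/
lemma StarAlgHom.surjective_of_denseRange (f : A →⋆ₐ[ℂ] B) (hf : DenseRange f) :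
    Function.Surjective f := by
  let F : NormedAddGroupHom A B :=
    { toFun := f
      map_add' := map_add f
      bound' := ⟨1, fun x => by rw [one_mul]; exact NonUnitalStarAlgHom.norm_apply_le f x⟩ }
  have h : F.SurjectiveOnWith F.range 2 := by
    rintro _ ⟨a, rfl⟩
    exact f.exists_lift_norm_le a
  intro b
  obtain ⟨a, ha, -⟩ := controlled_closure_of_complete two_pos one_pos h b (hf b)
  exact ⟨a, ha⟩

end DenseRange

/-! ### The universal property of `C(SU_q(n))` -/

namespace FreeStarAlgebra

lemma hom_ext {X : Type} {B : Type w} [Ring B] [Algebra ℂ B] [StarRing B]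
    {f g : FreeStarAlgebra X →⋆ₐ[ℂ] B}
    (h : ∀ x, f (var (Sum.inl x)) = g (var (Sum.inl x))) : f = g := by
  refine StarAlgHom.ext fun a => ?_
  induction a using ind with
  | h0 c => exact (AlgHomClass.commutes f c).trans (AlgHomClass.commutes g c).symm
  | h1 s =>
    cases s with
    | inl x => exact h x
    | inr x =>
      have hx : (var (Sum.inr x) : FreeStarAlgebra X) = star (var (Sum.inl x)) :=
        (star_var (Sum.inl x)).symm
      rw [hx, map_star, map_star, h]
  | hm a b ha hb => rw [map_mul, map_mul, ha, hb]
  | ha a b ha hb => rw [map_add, map_add, ha, hb]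

end FreeStarAlgebra

lemma IsSUqMatrix.map {q : ℝ} {n : ℕ} {A : Type v} {B : Type w} [Ring A] [Algebra ℂ A]
    [StarRing A] [Ring B] [Algebra ℂ B] [StarRing B] {x : Fin n → Fin n → A}
    (hx : IsSUqMatrix q n x) (f : A →⋆ₐ[ℂ] B) : IsSUqMatrix q n fun i j => f (x i j) where
  mul_star i j := by
    simpa [map_sum, map_mul, map_star, apply_ite f] using congrArg f (hx.mul_star i j)
  star_mul i j := by
    simpa [map_sum, map_mul, map_star, apply_ite f] using congrArg f (hx.star_mul i j)
  det j := by
    have h := congrArg f (hx.det j)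
    rw [map_sum, map_smul, map_one] at h
    rw [← h]
    refine Finset.sum_congr rfl fun i _ => ?_
    rw [map_smul, map_list_prod, List.map_ofFn]
    rfl

namespace CSUq

variable {q : ℝ} {n : ℕ}

/-- The norm of the difference is a supremum over models, and every term of it vanishes. This is how
relations are transferred from the models to the universal algebra. -/
lemma coeHom_eq_of_forall {x y : FreeStarAlgebra (Fin n × Fin n)}
    (h : ∀ M : SUqModel q n, M.eval x = M.eval y) : coeHom q n x = coeHom q n y := by
  rw [← sub_eq_zero, ← map_sub, ← norm_le_zero_iff]
  refine ((suqSeminorm q n).norm_coe (x - y)).trans_le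
    (CStarSeminorm.ofFamily_le _ _ _ le_rfl fun M => ?_)
  rw [map_sub, h M, sub_self, norm_zero]

/-- The generators of the free `*`-algebra, as a matrix. -/
def freeVar (n : ℕ) (i j : Fin n) : FreeStarAlgebra (Fin n × Fin n) :=
  FreeStarAlgebra.var (Sum.inl (i, j))

lemma eval_freeVar (M : SUqModel q n) (i j : Fin n) : M.eval (freeVar n i j) = M.u i j :=
  FreeStarAlgebra.eval_var _ _

lemma u_eq (i j : Fin n) : u q n i j = coeHom q n (freeVar n i j) := rfl

/-- The generators of `C(SU_q(n))` satisfy the defining relations. -/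
lemma isSUqMatrix : IsSUqMatrix q n (u q n) where
  mul_star i j := by
    have h : coeHom q n (∑ k, freeVar n i k * star (freeVar n j k)) =
        coeHom q n (if i = j then 1 else 0) := coeHom_eq_of_forall fun M => by
      simpa [map_sum, map_mul, map_star, eval_freeVar, apply_ite M.eval] using M.isSUq.mul_star i j
    simpa [map_sum, map_mul, map_star, ← u_eq, apply_ite (coeHom q n)] using h
  star_mul i j := by
    have h : coeHom q n (∑ k, star (freeVar n k i) * freeVar n k j) =
        coeHom q n (if i = j then 1 else 0) := coeHom_eq_of_forall fun M => by
      simpa [map_sum, map_mul, map_star, eval_freeVar, apply_ite M.eval] using M.isSUq.star_mul i j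
    simpa [map_sum, map_mul, map_star, ← u_eq, apply_ite (coeHom q n)] using h
  det j := by
    have key : ∀ {B : Type} [CStarAlgebra B] (f : FreeStarAlgebra (Fin n × Fin n) →⋆ₐ[ℂ] B),
        f (∑ i : Fin n → Fin n, qLeviCivita q i •
          (List.ofFn fun k => freeVar n (j k) (i k)).prod) =
        ∑ i : Fin n → Fin n, qLeviCivita q i •
          (List.ofFn fun k => f (freeVar n (j k) (i k))).prod := fun f => by
      rw [map_sum]
      refine Finset.sum_congr rfl fun i _ => ?_
      rw [map_smul, map_list_prod, List.map_ofFn]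
      rfl
    have h : coeHom q n (∑ i : Fin n → Fin n, qLeviCivita q i •
          (List.ofFn fun k => freeVar n (j k) (i k)).prod) =
        coeHom q n (qLeviCivita q j • 1) := coeHom_eq_of_forall fun M => by
      rw [key, map_smul, map_one, ← M.isSUq.det j]
      simp only [eval_freeVar]
    rw [key, map_smul, map_one] at h
    exact h

/-- The homomorphism out of `C(SU_q(n))` given by a matrix satisfying the defining relations. -/
def lift {B : Type} [CStarAlgebra B] (x : Fin n → Fin n → B) (hx : IsSUqMatrix q n x) :
    CSUq q n →⋆ₐ[ℂ] B :=
  (suqSeminorm q n).lift (SUqModel.eval (q := q) ⟨B, x, hx⟩) fun y =>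
    CStarSeminorm.le_ofFamily (fun M : SUqModel q n => M.eval) _ ⟨B, x, hx⟩ y

lemma lift_u {B : Type} [CStarAlgebra B] (x : Fin n → Fin n → B) (hx : IsSUqMatrix q n x)
    (i j : Fin n) : lift x hx (u q n i j) = x i j :=
  ((suqSeminorm q n).lift_coe _ _ _).trans (eval_freeVar ⟨B, x, hx⟩ i j)

lemma hom_ext {B : Type w} [CStarAlgebra B] {f g : CSUq q n →⋆ₐ[ℂ] B}
    (h : ∀ i j, f (u q n i j) = g (u q n i j)) : f = g := by
  have h' : f.comp (coeHom q n) = g.comp (coeHom q n) :=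
    FreeStarAlgebra.hom_ext fun x => h x.1 x.2
  exact CStarSeminorm.hom_ext (p := suqSeminorm q n) fun x => DFunLike.congr_fun h' x

lemma qLeviCivita_ne_zero (hq : q ≠ 0) {i : Fin n → Fin n} (hi : Function.Injective i) :
    qLeviCivita q i ≠ 0 := by
  rw [qLeviCivita, if_pos hi]
  exact pow_ne_zero _ (neg_ne_zero.2 (Complex.ofReal_ne_zero.2 hq))

end CSUq

/-- The adjoint of an entry of a matrix satisfying the relations of `C(SU_q(n))` is a polynomial
in the entries. -/
lemma IsSUqMatrix.star_mem_adjoin {q : ℝ} (hq : q ≠ 0) {n : ℕ} {B : Type w} [Ring B]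
    [Algebra ℂ B] [StarRing B] {x : Fin n → Fin n → B} (hx : IsSUqMatrix q n x) (p m : Fin n) :
    star (x p m) ∈ Algebra.adjoin ℂ (Set.range fun i : Fin n × Fin n => x i.1 i.2) := by
  -- An index `p` exists, so the matrix has at least one row; one factor can be split off each
  -- product.
  obtain ⟨n, rfl⟩ : ∃ k, n = k + 1 := ⟨n - 1, by have := p.pos; omega⟩
  set S := Algebra.adjoin ℂ (Set.range fun i : Fin (n + 1) × Fin (n + 1) => x i.1 i.2) with hS
  -- `J a` is `a` followed by all indices other than `p` in increasing order; it is injective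
  -- exactly for `a = p`.
  let J : Fin (n + 1) → Fin (n + 1) → Fin (n + 1) := fun a => Fin.cons a p.succAbove
  have hJp : Function.Injective (J p) := Fin.cons_injective_iff.2
    ⟨by rintro ⟨k, hk⟩; exact Fin.succAbove_ne p k hk, Fin.succAbove_right_injective⟩
  have hJ : ∀ a, a ≠ p → qLeviCivita q (J a) = 0 := fun a ha => by
    rw [qLeviCivita, if_neg]
    intro h
    obtain ⟨k, hk⟩ := Fin.exists_succAbove_eq ha
    exact (Fin.cons_injective_iff.1 h).1 ⟨k, hk⟩
  -- The same sum is evaluated in two ways. Here the determinant relation for `J a` leaves only the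
  -- term `a = p`, a multiple of the adjoint sought.
  have key : ∑ a, star (x a m) * (∑ i : Fin (n + 1) → Fin (n + 1), qLeviCivita q i •
      (List.ofFn fun k => x (J a k) (i k)).prod) = qLeviCivita q (J p) • star (x p m) := by
    rw [Finset.sum_eq_single p]
    · rw [hx.det, mul_smul_comm, mul_one]
    · intro a _ ha
      rw [hx.det, hJ a ha, zero_smul, mul_zero]
    · simp
  -- Summing over `a` first instead, the adjoint meets the leading factor `x a (i 0)` and unitarity
  -- replaces both by a Kronecker delta; only products of entries remain.
  have key2 : ∑ a, star (x a m) * (∑ i : Fin (n + 1) → Fin (n + 1), qLeviCivita q i •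
      (List.ofFn fun k => x (J a k) (i k)).prod) ∈ S := by
    simp_rw [Finset.mul_sum, mul_smul_comm]
    rw [Finset.sum_comm]
    refine S.sum_mem fun i _ => ?_
    rw [← Finset.smul_sum]
    refine S.smul_mem ?_ _
    have h1 : ∀ a, star (x a m) * (List.ofFn fun k => x (J a k) (i k)).prod =
        (star (x a m) * x a (i 0)) *
          (List.ofFn fun k : Fin n => x (p.succAbove k) (i k.succ)).prod := fun a => by
      rw [List.ofFn_succ, List.prod_cons, mul_assoc]
      simp [J]
    simp_rw [h1]
    rw [← Finset.sum_mul, hx.star_mul]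
    refine S.mul_mem ?_ (S.list_prod_mem fun y hy => ?_)
    · split_ifs
      · exact S.one_mem
      · exact S.zero_mem
    · obtain ⟨k, rfl⟩ := (List.mem_ofFn' _ _).1 hy
      exact Algebra.subset_adjoin ⟨(_, _), rfl⟩
  rw [key] at key2
  have h := S.smul_mem key2 (qLeviCivita q (J p))⁻¹
  rwa [smul_smul, inv_mul_cancel₀ (CSUq.qLeviCivita_ne_zero hq hJp), one_smul] at h

namespace CSUq

variable {q : ℝ} {n : ℕ}

/-- The subalgebra generated by the matrix entries, without their adjoints. -/
def polySubalgebra (q : ℝ) (n : ℕ) : Subalgebra ℂ (CSUq q n) :=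
  Algebra.adjoin ℂ (Set.range fun i : Fin n × Fin n => u q n i.1 i.2)

lemma u_mem_polySubalgebra (i j : Fin n) : u q n i j ∈ polySubalgebra q n :=
  Algebra.subset_adjoin ⟨(i, j), rfl⟩

lemma coeHom_mem_polySubalgebra (hq : q ≠ 0) (x : FreeStarAlgebra (Fin n × Fin n)) :
    coeHom q n x ∈ polySubalgebra q n := by
  induction x using FreeStarAlgebra.ind with
  | h0 c =>
    rw [AlgHomClass.commutes]
    exact Subalgebra.algebraMap_mem _ c
  | h1 s =>
    cases s with
    | inl x => exact u_mem_polySubalgebra x.1 x.2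
    | inr x =>
      have hx : (FreeStarAlgebra.var (Sum.inr x) : FreeStarAlgebra (Fin n × Fin n)) =
        star (freeVar n x.1 x.2) := (FreeStarAlgebra.star_var (Sum.inl x)).symm
      rw [hx, map_star]
      exact isSUqMatrix.star_mem_adjoin hq x.1 x.2
  | hm a b ha hb => rw [map_mul]; exact mul_mem ha hb
  | ha a b ha hb => rw [map_add]; exact add_mem ha hb

/-- Adjoints of generators are already polynomials in the entries, so all $*$-polynomials lie in
this subalgebra. -/
lemma dense_polySubalgebra (hq : q ≠ 0) : Dense (polySubalgebra q n : Set (CSUq q n)) :=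
  (suqSeminorm q n).denseRange_coe.mono (by
    rintro _ ⟨x, rfl⟩
    exact coeHom_mem_polySubalgebra hq x)

end CSUq

/-! ### The connecting homomorphisms -/

/-! ### Inserting the largest index: effect on inversions and on $E$ -/

section LeviCivita

lemma List.prod_ofFn_eq_prod_succAbove {M : Type*} [Monoid M] : ∀ {n : ℕ} (p : Fin (n + 1))
    (f : Fin (n + 1) → M), f p = 1 →
    (List.ofFn f).prod = (List.ofFn fun k => f (p.succAbove k)).prod
  | 0, p, f, h => by
    obtain rfl : p = 0 := Subsingleton.elim (α := Fin 1) p 0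
    simp [h]
  | n + 1, p, f, h => by
    induction p using Fin.cases with
    | zero => rw [List.ofFn_succ, List.prod_cons, h, one_mul]; simp
    | succ p =>
      rw [List.ofFn_succ, List.prod_cons, List.prod_ofFn_eq_prod_succAbove p _ h]
      conv_rhs => rw [List.ofFn_succ, List.prod_cons]
      simp

lemma List.prod_ofFn_eq_zero {M : Type*} [MonoidWithZero M] {n : ℕ} {f : Fin n → M} (k : Fin n)
    (h : f k = 0) : (List.ofFn f).prod = 0 :=
  List.prod_eq_zero ((List.mem_ofFn' _ _).2 ⟨k, h⟩)

/-- The sequence `i` with the largest value inserted at position `p`. -/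
def insertLast {n : ℕ} (p : Fin (n + 1)) (i : Fin n → Fin n) : Fin (n + 1) → Fin (n + 1) :=
  p.insertNth (α := fun _ => Fin (n + 1)) (Fin.last n) fun k => (i k).castSucc

variable {n : ℕ} (p : Fin (n + 1)) (i : Fin n → Fin n)

@[simp] lemma insertLast_same : insertLast p i p = Fin.last n := Fin.insertNth_apply_same ..

@[simp] lemma insertLast_succAbove (k : Fin n) : insertLast p i (p.succAbove k) = (i k).castSucc :=
  Fin.insertNth_apply_succAbove ..

lemma insertLast_injective : Function.Injective (insertLast p) := fun i j h => funext fun k =>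
  Fin.castSucc_injective n (by rw [← insertLast_succAbove p i, h, insertLast_succAbove])

lemma exists_eq_insertLast {j : Fin (n + 1) → Fin (n + 1)} (h : j p = Fin.last n)
    (h' : ∀ k, j (p.succAbove k) ≠ Fin.last n) : ∃ i, insertLast p i = j := by
  refine ⟨fun k => (j (p.succAbove k)).castPred (h' k), funext fun k => ?_⟩
  cases k using p.succAboveCases with
  | x => rw [insertLast_same, h]
  | p k => rw [insertLast_succAbove, Fin.castSucc_castPred]

lemma injective_insertLast_iff : Function.Injective (insertLast p i) ↔ Function.Injective i := by
  refine ⟨fun h a b hab => p.succAbove_right_injective (h ?_), fun h a b hab => ?_⟩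
  · rw [insertLast_succAbove, insertLast_succAbove, hab]
  · cases a using p.succAboveCases with
    | x =>
      cases b using p.succAboveCases with
      | x => rfl
      | p b =>
        rw [insertLast_same, insertLast_succAbove] at hab
        exact absurd hab.symm (Fin.castSucc_lt_last _).ne
    | p a =>
      cases b using p.succAboveCases with
      | x =>
        rw [insertLast_same, insertLast_succAbove] at hab
        exact absurd hab (Fin.castSucc_lt_last _).ne
      | p b =>
        rw [insertLast_succAbove, insertLast_succAbove] at hab
        rw [h (Fin.castSucc_injective n hab)]

lemma inversions_eq_sum {n : ℕ} (i : Fin n → Fin n) :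
    inversions i = ∑ a, ∑ b, if a < b ∧ i b < i a then 1 else 0 := by
  rw [inversions, Finset.card_filter, Fintype.sum_prod_type]

/-- The inserted maximum is inverted with exactly the entries to its right. Their number depends on
`p` only, so it need not be evaluated: it contributes the same power of $-q$ to both sides of the
determinant relation. -/
lemma inversions_insertLast : inversions (insertLast p i) =
    (∑ k, if p < p.succAbove k then 1 else 0) + inversions i := by
  rw [inversions_eq_sum, inversions_eq_sum, Fin.sum_univ_succAbove _ p]
  congr 1
  · rw [Fin.sum_univ_succAbove _ p]
    simp [Fin.castSucc_lt_last]
  · refine Finset.sum_congr rfl fun a _ => ?_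
    rw [Fin.sum_univ_succAbove _ p]
    simp [(Fin.castSucc_lt_last (i a)).le.not_gt, p.strictMono_succAbove.lt_iff_lt]

lemma qLeviCivita_insertLast (q : ℝ) : qLeviCivita q (insertLast p i) =
    (-(q : ℂ)) ^ (∑ k, if p < p.succAbove k then 1 else 0) * qLeviCivita q i := by
  by_cases h : Function.Injective i
  · rw [qLeviCivita, qLeviCivita, if_pos h, if_pos ((injective_insertLast_iff p i).2 h),
      inversions_insertLast, pow_add]
  · rw [qLeviCivita, qLeviCivita, if_neg h, if_neg (mt (injective_insertLast_iff p i).1 h),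
      mul_zero]

end LeviCivita

/-! ### The block matrix with blocks $x$ and $1$ satisfies the relations -/

section Block

variable {n : ℕ} {B : Type w} [Ring B]

/-- The block diagonal matrix with blocks `x` and `1`. -/
def blockOne (x : Fin n → Fin n → B) (i j : Fin (n + 1)) : B :=
  if h : i.val < n ∧ j.val < n then x ⟨i.val, h.1⟩ ⟨j.val, h.2⟩ else if i = j then 1 else 0

variable (x : Fin n → Fin n → B)

@[simp] lemma blockOne_castSucc (i j : Fin n) : blockOne x i.castSucc j.castSucc = x i j := by
  simp [blockOne]

@[simp] lemma blockOne_last : blockOne x (Fin.last n) (Fin.last n) = 1 := by simp [blockOne]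

lemma blockOne_last_left {j : Fin (n + 1)} (h : j ≠ Fin.last n) :
    blockOne x (Fin.last n) j = 0 := by simp [blockOne, h.symm]

lemma blockOne_last_right {i : Fin (n + 1)} (h : i ≠ Fin.last n) :
    blockOne x i (Fin.last n) = 0 := by simp [blockOne, h]

/-- Unitarity is blockwise. In the determinant relation a product survives only if `i` and `j` take
the last value at the same positions, which reduces the sum to the relation of size `n` or makes
both sides zero. -/
lemma IsSUqMatrix.blockOne [Algebra ℂ B] [StarRing B] {q : ℝ} {x : Fin n → Fin n → B}
    (hx : IsSUqMatrix q n x) : IsSUqMatrix q (n + 1) (_root_.blockOne x) where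
  mul_star i j := by
    rw [Fin.sum_univ_castSucc]
    induction i using Fin.lastCases with
    | last =>
      induction j using Fin.lastCases with
      | last => simp [blockOne_last_left]
      | cast j => simp [blockOne_last_left, blockOne_last_right, (Fin.castSucc_lt_last j).ne']
    | cast i =>
      induction j using Fin.lastCases with
      | last => simp [blockOne_last_left, blockOne_last_right]
      | cast j => simp [blockOne_last_right, hx.mul_star]
  star_mul i j := by
    rw [Fin.sum_univ_castSucc]
    induction i using Fin.lastCases with
    | last =>
      induction j using Fin.lastCases with
      | last => simp [blockOne_last_right]
      | cast j => simp [blockOne_last_left, blockOne_last_right, (Fin.castSucc_lt_last j).ne']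
    | cast i =>
      induction j using Fin.lastCases with
      | last => simp [blockOne_last_left, blockOne_last_right]
      | cast j => simp [blockOne_last_left, hx.star_mul]
  det j := by
    have hzero : ∀ i : Fin (n + 1) → Fin (n + 1), ∀ k,
        ((j k = Fin.last n ∧ i k ≠ Fin.last n) ∨ (j k ≠ Fin.last n ∧ i k = Fin.last n)) →
        qLeviCivita q i • (List.ofFn fun k => _root_.blockOne x (j k) (i k)).prod = 0 := by
      intro i k hk
      rw [List.prod_ofFn_eq_zero k, smul_zero]
      rcases hk with ⟨h1, h2⟩ | ⟨h1, h2⟩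
      · rw [h1, blockOne_last_left x h2]
      · rw [h2, blockOne_last_right x h1]
    -- The split is on whether `j` takes the last value exactly once. If it does, `j` need not be
    -- injective; the relation of size `n` covers that as well.
    by_cases hj : ∃ p, j p = Fin.last n ∧ ∀ k, j (p.succAbove k) ≠ Fin.last n
    · obtain ⟨p, hp, hk⟩ := hj
      obtain ⟨j, rfl⟩ := exists_eq_insertLast p hp hk
      rw [qLeviCivita_insertLast, mul_smul, ← hx.det j, Finset.smul_sum]
      symm
      -- An `i` outside the image of `insertLast p` either misses the last value at `p` or takes it
      -- again elsewhere; both give an off-diagonal zero factor.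
      refine Fintype.sum_of_injective (insertLast p) (insertLast_injective p) _ _
        (fun i hi => ?_) fun i => ?_
      · by_cases hip : i p = Fin.last n
        · by_contra hne
          refine hi (exists_eq_insertLast p hip fun k hik => hne (hzero i _ (Or.inr ⟨hk k, hik⟩)))
        · exact hzero i p (Or.inl ⟨hp, hip⟩)
      · rw [qLeviCivita_insertLast, mul_smul, List.prod_ofFn_eq_prod_succAbove p _ (by simp)]
        simp
    -- Here `j` is not injective, since an injective self-map of a finite set takes each value once.
    -- An injective `i` takes the last value once, so its positions cannot match those of `j` and
    -- its product vanishes.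
    · rw [qLeviCivita, if_neg, zero_smul]
      · refine Finset.sum_eq_zero fun i _ => ?_
        by_cases hi : Function.Injective i
        · obtain ⟨p, hp⟩ := Finite.injective_iff_surjective.1 hi (Fin.last n)
          by_cases hjp : j p = Fin.last n
          · push Not at hj
            obtain ⟨k, hk⟩ := hj p hjp
            exact hzero i _ (Or.inl ⟨hk, fun h => p.succAbove_ne k (hi (h.trans hp.symm))⟩)
          · exact hzero i p (Or.inr ⟨hjp, hp⟩)
        · rw [qLeviCivita, if_neg hi, zero_smul]
      · intro hinj
        obtain ⟨p, hp⟩ := Finite.injective_iff_surjective.1 hinj (Fin.last n)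
        exact hj ⟨p, hp, fun k h => p.succAbove_ne k (hinj (h.trans hp.symm))⟩

end Block

namespace CSUq

variable {q : ℝ} {n : ℕ}

/-- The restriction homomorphism `C(SU_q(n + 1)) → C(SU_q(n))`. -/
def restrict (q : ℝ) (n : ℕ) : CSUq q (n + 1) →⋆ₐ[ℂ] CSUq q n :=
  lift (blockOne (u q n)) isSUqMatrix.blockOne

lemma restrict_u (i j : Fin (n + 1)) : restrict q n (u q (n + 1) i j) = blockOne (u q n) i j :=
  lift_u _ _ i j

/-- The range is a subalgebra containing the entries $u_{ij}$ of the smaller matrix, hence dense. -/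
lemma restrict_surjective (hq : q ≠ 0) : Function.Surjective (restrict q n) := by
  refine StarAlgHom.surjective_of_denseRange _ ((dense_polySubalgebra hq).mono ?_)
  change polySubalgebra q n ≤ (restrict q n).toAlgHom.range
  refine Algebra.adjoin_le ?_
  rintro _ ⟨⟨i, j⟩, rfl⟩
  exact ⟨u q (n + 1) i.castSucc j.castSucc, (restrict_u _ _).trans (blockOne_castSucc _ i j)⟩

end CSUq

/-! ### Products of commuting matrices -/

section Mul

lemma List.prod_ofFn_sum {R ι : Type*} [Semiring R] [Fintype ι] : ∀ {n : ℕ} (f : Fin n → ι → R),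
    (List.ofFn fun k => ∑ a, f k a).prod = ∑ l : Fin n → ι, (List.ofFn fun k => f k (l k)).prod
  | 0, f => by simp
  | n + 1, f => by
    rw [List.ofFn_succ, List.prod_cons, List.prod_ofFn_sum, Finset.sum_mul_sum,
      ← Fintype.sum_prod_type', ← (Fin.consEquiv fun _ : Fin (n + 1) => ι).sum_comp]
    refine Finset.sum_congr rfl fun x _ => ?_
    rw [List.ofFn_succ, List.prod_cons]
    rfl

lemma List.prod_ofFn_mul {M : Type*} [Monoid M] : ∀ {n : ℕ} (f g : Fin n → M),
    (∀ i j, Commute (f i) (g j)) →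
    (List.ofFn fun k => f k * g k).prod = (List.ofFn f).prod * (List.ofFn g).prod
  | 0, f, g, _ => by simp
  | n + 1, f, g, h => by
    have hc : Commute (List.ofFn fun k : Fin n => f k.succ).prod (g 0) := by
      refine Commute.list_prod_left _ _ fun y hy => ?_
      obtain ⟨k, rfl⟩ := (List.mem_ofFn' _ _).1 hy
      exact h _ _
    rw [List.ofFn_succ, List.prod_cons, List.prod_ofFn_mul _ _ fun i j => h i.succ j.succ,
      List.ofFn_succ, List.ofFn_succ, List.prod_cons, List.prod_cons, mul_assoc, mul_assoc,
      ← mul_assoc (g 0), ← hc.eq, mul_assoc]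

/-- Regroups $(yz)(yz)^*$ as $y(zz^*)y^*$ entrywise, exposing the inner unitarity relation. -/
lemma Finset.sum_mul_mul_sum {R ι : Type*} [Semiring R] [Fintype ι] (a d : ι → R)
    (b c : ι → ι → R) : ∑ k, (∑ l, a l * b l k) * (∑ m, c m k * d m) =
      ∑ l, ∑ m, a l * (∑ k, b l k * c m k) * d m := by
  simp_rw [Finset.sum_mul_sum, Finset.mul_sum, Finset.sum_mul]
  rw [Finset.sum_comm]
  refine Finset.sum_congr rfl fun l _ => ?_
  rw [Finset.sum_comm]
  simp only [mul_assoc]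

/-- The product of two matrices satisfying the relations of `C(SU_q(n))` with commuting entries
satisfies them. -/
lemma IsSUqMatrix.mul {q : ℝ} {n : ℕ} {B : Type w} [Ring B] [Algebra ℂ B] [StarRing B]
    {y z : Fin n → Fin n → B} (hy : IsSUqMatrix q n y) (hz : IsSUqMatrix q n z)
    (h : ∀ i j k l, Commute (y i j) (z k l)) :
    IsSUqMatrix q n fun i j => ∑ k, y i k * z k j where
  mul_star i j := by
    simp_rw [star_sum, StarMul.star_mul, Finset.sum_mul_mul_sum, hz.mul_star]
    simp [hy.mul_star]
  star_mul i j := by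
    simp_rw [star_sum, StarMul.star_mul, Finset.sum_mul_mul_sum, hy.star_mul]
    simp [hz.star_mul]
  det j := by
    -- Only the determinant relation uses commutation: it sorts the `y` factors before the `z`
    -- factors. Summing over `i` then applies the relation of `z` to the rows `l`, and what remains
    -- is the relation of `y`.
    have h1 : ∀ i : Fin n → Fin n, (List.ofFn fun k => ∑ l, y (j k) l * z l (i k)).prod =
        ∑ l : Fin n → Fin n, (List.ofFn fun k => y (j k) (l k)).prod *
          (List.ofFn fun k => z (l k) (i k)).prod := fun i => by
      rw [List.prod_ofFn_sum]
      exact Finset.sum_congr rfl fun l _ => List.prod_ofFn_mul _ _ fun _ _ => h _ _ _ _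
    simp_rw [h1, Finset.smul_sum]
    rw [Finset.sum_comm]
    simp_rw [← mul_smul_comm, ← Finset.mul_sum, hz.det, mul_smul_comm, mul_one]
    exact hy.det j

end Mul

/-! ### Tensor products of homomorphisms -/

/-- The defining supremum controls the norm of arbitrary elements of the completion, by
approximation with elements of `P` and contractivity of the lifts. It is needed because
$(f\otimes\mathrm{id})(x)$ lies only in the completion. -/
lemma CStarSeminorm.norm_le_of_forall_lift {P : Type u} [Ring P] [Algebra ℂ P] [StarRing P]
    {ι : Type v} {B : ι → Type w} [∀ i, CStarAlgebra (B i)]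
    (φ : ∀ i, P →⋆ₐ[ℂ] B i) (hb : ∀ x, BddAbove (Set.range fun i => ‖φ i x‖)) [StarModule ℂ P]
    (z : (ofFamily φ hb).Completion) {c : ℝ} (hc : 0 ≤ c)
    (h : ∀ i, ‖(ofFamily φ hb).lift (φ i) (le_ofFamily φ hb i) z‖ ≤ c) : ‖z‖ ≤ c := by
  refine le_of_forall_pos_le_add fun ε hε => ?_
  obtain ⟨x, hx⟩ := Metric.denseRange_iff.1 (ofFamily φ hb).denseRange_coe z (ε / 2) (half_pos hε)
  rw [dist_eq_norm] at hx
  have h1 : ‖(ofFamily φ hb).coe x‖ ≤ c + ε / 2 := by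
    rw [norm_coe]
    refine ofFamily_le _ _ _ (by positivity) fun i => ?_
    rw [← lift_coe (ofFamily φ hb) (φ i) (le_ofFamily φ hb i)]
    have h2 := NonUnitalStarAlgHom.norm_apply_le ((ofFamily φ hb).lift (φ i) (le_ofFamily φ hb i))
      (z - (ofFamily φ hb).coe x)
    rw [map_sub] at h2
    have h3 := norm_sub_norm_le ((ofFamily φ hb).lift (φ i) (le_ofFamily φ hb i)
      ((ofFamily φ hb).coe x)) ((ofFamily φ hb).lift (φ i) (le_ofFamily φ hb i) z)
    rw [norm_sub_rev] at h3
    linarith [h i]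
  linarith [norm_sub_norm_le z ((ofFamily φ hb).coe x)]

/-- The `*`-homomorphism on an algebraic tensor product given by two `*`-homomorphisms with
commuting ranges. -/
def algTensorLift {P Q : Type u} {R : Type w} [Ring P] [Algebra ℂ P] [StarRing P] [StarModule ℂ P]
    [Ring Q] [Algebra ℂ Q] [StarRing Q] [StarModule ℂ Q] [Ring R] [Algebra ℂ R] [StarRing R]
    (f : P →⋆ₐ[ℂ] R) (g : Q →⋆ₐ[ℂ] R) (h : ∀ x y, Commute (f x) (g y)) :
    (P ⊗[ℂ] Q) →⋆ₐ[ℂ] R :=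
  { Algebra.TensorProduct.lift f.toAlgHom g.toAlgHom h with
    map_star' := fun z => by
      change Algebra.TensorProduct.lift f.toAlgHom g.toAlgHom h (star z) =
        star (Algebra.TensorProduct.lift f.toAlgHom g.toAlgHom h z)
      induction z with
      | zero => simp
      | add a b ha hb => rw [star_add, map_add, map_add, star_add, ha, hb]
      | tmul a b =>
        rw [TensorProduct.star_tmul, Algebra.TensorProduct.lift_tmul,
          Algebra.TensorProduct.lift_tmul, star_mul]
        -- The involution reverses the product; commuting ranges restore the order.
        have h1 : f (star a) * g (star b) = star (g b) * star (f a) := by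
          rw [(h _ _).eq, map_star, map_star]
        exact h1 }

lemma algTensorLift_tmul {P Q : Type u} {R : Type w} [Ring P] [Algebra ℂ P] [StarRing P]
    [StarModule ℂ P] [Ring Q] [Algebra ℂ Q] [StarRing Q] [StarModule ℂ Q] [Ring R] [Algebra ℂ R]
    [StarRing R] (f : P →⋆ₐ[ℂ] R) (g : Q →⋆ₐ[ℂ] R) (h : ∀ x y, Commute (f x) (g y)) (x : P) (y : Q) :
    algTensorLift f g h (x ⊗ₜ y) = f x * g y :=
  Algebra.TensorProduct.lift_tmul f.toAlgHom g.toAlgHom h x y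

section Ampliation

variable (H K : Type u) [NormedAddCommGroup H] [InnerProductSpace ℂ H] [CompleteSpace H]
  [NormedAddCommGroup K] [InnerProductSpace ℂ K] [CompleteSpace K]

/-- The ampliation `S ↦ S ⊗ 1`. -/
def ampLeft : (H →L[ℂ] H) →⋆ₐ[ℂ] (HilbertTensor H K →L[ℂ] HilbertTensor H K) :=
  (repTensor (StarAlgHom.id ℂ _) (StarAlgHom.id ℂ _)).comp
    (algInclLeft (H →L[ℂ] H) (K →L[ℂ] K))

/-- The ampliation `T ↦ 1 ⊗ T`. -/
def ampRight : (K →L[ℂ] K) →⋆ₐ[ℂ] (HilbertTensor H K →L[ℂ] HilbertTensor H K) :=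
  (repTensor (StarAlgHom.id ℂ _) (StarAlgHom.id ℂ _)).comp
    (algInclRight (H →L[ℂ] H) (K →L[ℂ] K))

variable {H K}

lemma ampLeft_apply (S : H →L[ℂ] H) : ampLeft H K S = opTensor S 1 := rfl
lemma ampRight_apply (T : K →L[ℂ] K) : ampRight H K T = opTensor 1 T := rfl

end Ampliation

/-! ### The associator of the Hilbert space tensor product -/

section HilbertAssoc

open TensorProduct

variable (H K L : Type u) [NormedAddCommGroup H] [InnerProductSpace ℂ H]
  [NormedAddCommGroup K] [InnerProductSpace ℂ K] [NormedAddCommGroup L] [InnerProductSpace ℂ L]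

namespace HilbertTensor

/-- The embedding of the algebraic threefold tensor product, bracketed to the left. -/
def coeLeft : ((H ⊗[ℂ] K) ⊗[ℂ] L) →ₗᵢ[ℂ] HilbertTensor (HilbertTensor H K) L :=
  coe.comp (mapIsometry coe LinearIsometry.id)

/-- The embedding of the algebraic threefold tensor product, bracketed to the right. -/
def coeRight : ((H ⊗[ℂ] K) ⊗[ℂ] L) →ₗᵢ[ℂ] HilbertTensor H (HilbertTensor K L) :=
  (coe.comp (mapIsometry LinearIsometry.id coe)).comp (assocIsometry ℂ H K L).toLinearIsometry

variable {H K L}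

lemma continuous_coe_tmul (l : L) : Continuous fun x : H => coe (x ⊗ₜ[ℂ] l) :=
  (coe (H := H) (K := L)).continuous.comp
    (continuous_tmul.comp (continuous_id.prodMk continuous_const))

/-- Two completions are involved, so density is proved twice: the closure of the range first absorbs
`x ⊗ l` with `x` in the completed tensor product, then limits of sums of these. -/
lemma denseRange_coeLeft : DenseRange (coeLeft H K L) := by
  have hmem : ∀ x : HilbertTensor H K ⊗[ℂ] L,
      coe x ∈ (LinearMap.range (coeLeft H K L).toLinearMap).topologicalClosure := by
    intro x
    induction x with
    | zero => rw [map_zero]; exact zero_mem _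
    | add a b ha hb => rw [map_add]; exact add_mem ha hb
    | tmul x l =>
      refine HilbertTensor.ind (motive := fun x => coe (x ⊗ₜ[ℂ] l) ∈
        (LinearMap.range (coeLeft H K L).toLinearMap).topologicalClosure) ?_ (fun x => ?_) x
      · exact (Submodule.isClosed_topologicalClosure _).preimage (continuous_coe_tmul l)
      · exact Submodule.le_topologicalClosure _ ⟨x ⊗ₜ l, rfl⟩
  intro x
  refine HilbertTensor.ind (motive := fun x => x ∈ closure (Set.range (coeLeft H K L)))
    isClosed_closure (fun x => ?_) x
  have := hmem x
  rwa [← SetLike.mem_coe, Submodule.topologicalClosure_coe] at this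

variable (H K L) in
/-- The associator, as a bounded operator. -/
def assocCLM : HilbertTensor (HilbertTensor H K) L →L[ℂ] HilbertTensor H (HilbertTensor K L) :=
  (coeRight H K L).toContinuousLinearMap.extend (coeLeft H K L).toContinuousLinearMap

lemma assocCLM_coeLeft (x : (H ⊗[ℂ] K) ⊗[ℂ] L) :
    assocCLM H K L (coeLeft H K L x) = coeRight H K L x :=
  ContinuousLinearMap.extend_eq (f := (coeRight H K L).toContinuousLinearMap)
    (e := (coeLeft H K L).toContinuousLinearMap) denseRange_coeLeft
    (coeLeft H K L).isometry.isUniformInducing x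

/-- An isometric intertwiner is enough to carry norm bounds from the right bracketing to the left
one; surjectivity plays no role. -/
lemma norm_assocCLM (x : HilbertTensor (HilbertTensor H K) L) : ‖assocCLM H K L x‖ = ‖x‖ :=
  denseRange_coeLeft.induction_on (p := fun x => ‖assocCLM H K L x‖ = ‖x‖) x
    (isClosed_eq (by fun_prop) (by fun_prop)) fun x => by
      rw [assocCLM_coeLeft, LinearIsometry.norm_map, LinearIsometry.norm_map]

/-- Bounded operators out of a threefold tensor product agree if they agree on elementary
tensors. -/
lemma ext_coeLeft {E : Type*} [NormedAddCommGroup E] [NormedSpace ℂ E]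
    {f g : HilbertTensor (HilbertTensor H K) L →L[ℂ] E}
    (h : ∀ x y z, f (coe (coe (x ⊗ₜ y) ⊗ₜ z)) = g (coe (coe (x ⊗ₜ y) ⊗ₜ z))) : f = g := by
  have h' : f.toLinearMap ∘ₗ (coeLeft H K L).toLinearMap =
      g.toLinearMap ∘ₗ (coeLeft H K L).toLinearMap :=
    TensorProduct.ext_threefold h
  refine ContinuousLinearMap.ext fun x => ?_
  exact denseRange_coeLeft.induction_on (p := fun x => f x = g x) x
    (isClosed_eq f.continuous g.continuous) fun x => LinearMap.congr_fun h' x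

lemma assocCLM_comp_opTensor (R : H →L[ℂ] H) (S : K →L[ℂ] K) (T : L →L[ℂ] L) :
    (assocCLM H K L).comp (opTensor (opTensor R S) T) =
      (opTensor R (opTensor S T)).comp (assocCLM H K L) :=
  ext_coeLeft fun x y z => by
    have h : ∀ (x : H) (y : K) (z : L), assocCLM H K L (coe (coe (x ⊗ₜ y) ⊗ₜ z)) =
        coe (x ⊗ₜ coe (y ⊗ₜ z)) := fun x y z => assocCLM_coeLeft ((x ⊗ₜ y) ⊗ₜ z)
    rw [ContinuousLinearMap.comp_apply, ContinuousLinearMap.comp_apply, h, opTensor_coe,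
      mapL_tmul, opTensor_coe, mapL_tmul, h, opTensor_coe, mapL_tmul, opTensor_coe, mapL_tmul]

end HilbertTensor

end HilbertAssoc

/-! ### The homomorphisms `Δ ⊗ id` and `id ⊗ Δ` -/

namespace SpatialTensor

variable {A B C D : Type u} [CStarAlgebra A] [CStarAlgebra B] [CStarAlgebra C] [CStarAlgebra D]

lemma ind {motive : SpatialTensor A B → Prop} (h : IsClosed {x | motive x})
    (hc : ∀ x : A ⊗[ℂ] B, motive (coeHom A B x)) (x : SpatialTensor A B) : motive x :=
  (spatialSeminorm A B).ind h hc x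

lemma inclLeft_apply (a : A) : inclLeft A B a = coeHom A B (a ⊗ₜ 1) := rfl

lemma inclRight_apply (b : B) : inclRight A B b = coeHom A B (1 ⊗ₜ b) := rfl

lemma inclLeft_mul_inclRight (a : A) (b : B) : inclLeft A B a * inclRight A B b = tmul a b := by
  rw [inclLeft_apply, inclRight_apply, ← map_mul, Algebra.TensorProduct.tmul_mul_tmul, mul_one,
    one_mul, tmul]

lemma commute_incl (a : A) (b : B) : Commute (inclLeft A B a) (inclRight A B b) := by
  rw [Commute, SemiconjBy, inclLeft_apply, inclRight_apply, ← map_mul, ← map_mul,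
    Algebra.TensorProduct.tmul_mul_tmul, Algebra.TensorProduct.tmul_mul_tmul]
  simp only [mul_one, one_mul]

lemma commute_leg₁₂_leg₃ (w : SpatialTensor A B) (c : C) :
    Commute (leg₁₂ A B C w) (leg₃ A B C c) := by
  refine ind (motive := fun w => leg₁₂ A B C w * leg₃ A B C c = leg₃ A B C c * leg₁₂ A B C w)
    (isClosed_eq ((starAlgHom_continuous _).mul continuous_const)
      (continuous_const.mul (starAlgHom_continuous _))) (fun x => ?_) w
  change _ * coeHom₃ A B C (1 ⊗ₜ c) = coeHom₃ A B C (1 ⊗ₜ c) * _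
  rw [leg₁₂_coe, ← map_mul, ← map_mul, Algebra.TensorProduct.tmul_mul_tmul,
    Algebra.TensorProduct.tmul_mul_tmul]
  simp only [mul_one, one_mul]

lemma commute_leg₁_leg₂₃ (a : A) (w : SpatialTensor B C) :
    Commute (leg₁ A B C a) (leg₂₃ A B C w) := by
  refine ind (motive := fun w => leg₁ A B C a * leg₂₃ A B C w = leg₂₃ A B C w * leg₁ A B C a)
    (isClosed_eq (continuous_const.mul (starAlgHom_continuous _))
      ((starAlgHom_continuous _).mul continuous_const)) (fun x => ?_) w
  change coeHom₃ A B C ((a ⊗ₜ 1) ⊗ₜ 1) * _ = _ * coeHom₃ A B C ((a ⊗ₜ 1) ⊗ₜ 1)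
  rw [leg₂₃_coe, ← map_mul, ← map_mul]
  congr 1
  induction x with
  | zero => simp only [map_zero, mul_zero, zero_mul]
  | add a b ha hb => simp only [map_add, mul_add, add_mul, ha, hb]
  | tmul b c =>
    simp only [algTensorMap_tmul, algInclRight_apply, Algebra.TensorProduct.tmul_mul_tmul, mul_one,
      one_mul]

lemma leg₁₂_inclLeft (a : A) : leg₁₂ A B C (inclLeft A B a) = leg₁ A B C a := leg₁₂_coe _

lemma leg₂₃_inclRight (c : C) : leg₂₃ A B C (inclRight B C c) = leg₃ A B C c := leg₂₃_coe _

/-- Both are $1\otimes b\otimes1$; this identification of the middle leg is what coassociativity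
rests on. -/
lemma leg₁₂_inclRight (b : B) : leg₁₂ A B C (inclRight A B b) = leg₂₃ A B C (inclLeft B C b) :=
  (leg₁₂_coe (1 ⊗ₜ b)).trans (leg₂₃_coe (b ⊗ₜ 1)).symm

/-! ### Product representations of minimal tensor products -/

section Rep

variable {H K L : Type u} [NormedAddCommGroup H] [InnerProductSpace ℂ H] [CompleteSpace H]
  [NormedAddCommGroup K] [InnerProductSpace ℂ K] [CompleteSpace K]
  [NormedAddCommGroup L] [InnerProductSpace ℂ L] [CompleteSpace L]
  (π : A →⋆ₐ[ℂ] (H →L[ℂ] H)) (ρ : B →⋆ₐ[ℂ] (K →L[ℂ] K)) (τ : C →⋆ₐ[ℂ] (L →L[ℂ] L))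

lemma norm_repTensor_le (x : A ⊗[ℂ] B) : ‖repTensor π ρ x‖ ≤ (spatialSeminorm A B).toFun x :=
  CStarSeminorm.le_ofFamily (fun r : RepPair A B => repTensor r.π r.ρ) _ ⟨H, K, π, ρ⟩ x

lemma norm_repTensor₃_le (x : (A ⊗[ℂ] B) ⊗[ℂ] C) :
    ‖repTensor (repTensor π ρ) τ x‖ ≤ (spatialSeminorm₃ A B C).toFun x :=
  CStarSeminorm.le_ofFamily (fun r : RepTriple A B C => repTensor (repTensor r.π r.ρ) r.τ) _
    ⟨H, K, L, π, ρ, τ⟩ x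

/-- The tensor product of two representations, on the minimal tensor product. -/
def rep : SpatialTensor A B →⋆ₐ[ℂ] (HilbertTensor H K →L[ℂ] HilbertTensor H K) :=
  lift (repTensor π ρ) (norm_repTensor_le π ρ)

/-- The tensor product of three representations, on the minimal tensor product. -/
def rep₃ : SpatialTensor₃ A B C →⋆ₐ[ℂ]
    (HilbertTensor (HilbertTensor H K) L →L[ℂ] HilbertTensor (HilbertTensor H K) L) :=
  lift₃ (repTensor (repTensor π ρ) τ) (norm_repTensor₃_le π ρ τ)

lemma rep_coe (x : A ⊗[ℂ] B) : rep π ρ (coeHom A B x) = repTensor π ρ x := lift_coeHom _ _ _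

lemma rep₃_coe (x : (A ⊗[ℂ] B) ⊗[ℂ] C) :
    rep₃ π ρ τ (coeHom₃ A B C x) = repTensor (repTensor π ρ) τ x := lift₃_coeHom _ _ _

lemma rep₃_leg₁ (a : A) : rep₃ π ρ τ (leg₁ A B C a) = opTensor (opTensor (π a) 1) 1 := by
  refine (rep₃_coe π ρ τ ((a ⊗ₜ 1) ⊗ₜ 1)).trans ?_
  rw [repTensor_tmul, repTensor_tmul, map_one, map_one]

lemma rep₃_leg₃ (c : C) : rep₃ π ρ τ (leg₃ A B C c) = opTensor 1 (τ c) := by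
  refine (rep₃_coe π ρ τ (1 ⊗ₜ c)).trans ?_
  rw [repTensor_tmul, map_one]

lemma rep₃_leg₁₂ (w : SpatialTensor A B) :
    rep₃ π ρ τ (leg₁₂ A B C w) = opTensor (rep π ρ w) 1 := by
  have h : (rep₃ π ρ τ).comp (leg₁₂ A B C) = (ampLeft (HilbertTensor H K) L).comp (rep π ρ) :=
    hom_ext fun x => by
      rw [StarAlgHom.comp_apply, StarAlgHom.comp_apply, leg₁₂_coe, rep₃_coe, rep_coe,
        ampLeft_apply, repTensor_tmul, map_one]
  exact DFunLike.congr_fun h w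

/-- Threefold representations act on the left-bracketed Hilbert space, where an operator on the last
two factors is not visibly of the form $1\otimes T$; it becomes so after the associator. -/
lemma assocCLM_comp_rep₃_leg₂₃ (w : SpatialTensor B C) :
    (HilbertTensor.assocCLM H K L).comp (rep₃ π ρ τ (leg₂₃ A B C w)) =
      (opTensor 1 (rep ρ τ w)).comp (HilbertTensor.assocCLM H K L) := by
  -- As a $*$-homomorphism, the ampliation is automatically continuous, which makes the identity a
  -- closed condition on `w`.
  simp_rw [← ampRight_apply]
  refine ind (motive := fun w =>
    (HilbertTensor.assocCLM H K L).comp (rep₃ π ρ τ (leg₂₃ A B C w)) =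
      (ampRight H (HilbertTensor K L) (rep ρ τ w)).comp (HilbertTensor.assocCLM H K L))
    (isClosed_eq ?_ ?_) (fun x => ?_) w
  · exact continuous_const.clm_comp ((starAlgHom_continuous _).comp (starAlgHom_continuous _))
  · exact ((starAlgHom_continuous _).comp (starAlgHom_continuous _)).clm_comp continuous_const
  · rw [leg₂₃_coe, rep₃_coe, rep_coe]
    induction x with
    | zero => simp only [map_zero, ContinuousLinearMap.comp_zero, ContinuousLinearMap.zero_comp]
    | add a b ha hb =>
      simp only [map_add, ContinuousLinearMap.comp_add, ContinuousLinearMap.add_comp, ha, hb]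
    | tmul b c =>
      rw [algTensorMap_tmul, algInclRight_apply, repTensor_tmul, repTensor_tmul, map_one,
        repTensor_tmul, ampRight_apply]
      exact HilbertTensor.assocCLM_comp_opTensor _ _ _

end Rep

/-- The norm of the threefold minimal tensor product is determined by tensor products of
representations. -/
lemma norm_le_of_forall_rep₃ (z : SpatialTensor₃ A B C) {c : ℝ} (hc : 0 ≤ c)
    (h : ∀ r : RepTriple A B C, ‖rep₃ r.π r.ρ r.τ z‖ ≤ c) : ‖z‖ ≤ c :=
  CStarSeminorm.norm_le_of_forall_lift
    (fun r : RepTriple A B C => repTensor (repTensor r.π r.ρ) r.τ) _ z hc h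

/-- The homomorphism `f ⊗ id` on the algebraic tensor product, for `f : A → B ⊗ C`. -/
def algTensorId (f : A →⋆ₐ[ℂ] SpatialTensor B C) (D : Type u) [CStarAlgebra D] :
    (A ⊗[ℂ] D) →⋆ₐ[ℂ] SpatialTensor₃ B C D :=
  algTensorLift ((leg₁₂ B C D).comp f) (leg₃ B C D) fun a _ => commute_leg₁₂_leg₃ (f a) _

lemma algTensorId_tmul (f : A →⋆ₐ[ℂ] SpatialTensor B C) (a : A) (d : D) :
    algTensorId f D (a ⊗ₜ d) = leg₁₂ B C D (f a) * leg₃ B C D d := algTensorLift_tmul _ _ _ _ _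

/-- Composing $\pi\otimes\rho\otimes\tau$ with $f\otimes\mathrm{id}$ gives the product of the
representations $(\pi\otimes\rho)\circ f$ and $\tau$, one of those in the supremum defining the
spatial norm. The left bracketing fits, so no associator is needed. -/
lemma norm_algTensorId_le (f : A →⋆ₐ[ℂ] SpatialTensor B C) (x : A ⊗[ℂ] D) :
    ‖algTensorId f D x‖ ≤ (spatialSeminorm A D).toFun x := by
  refine norm_le_of_forall_rep₃ _ (apply_nonneg (spatialSeminorm A D).toSeminorm x) fun r => ?_
  refine (congrArg norm ?_).trans_le (norm_repTensor_le ((rep r.π r.ρ).comp f) r.τ x)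
  induction x with
  | zero => simp only [map_zero]
  | add a b ha hb => simp only [map_add, ha, hb]
  | tmul a b =>
    rw [algTensorId_tmul, map_mul, rep₃_leg₁₂, rep₃_leg₃, ← opTensor_mul,
      mul_one, one_mul]
    rfl

/-- The homomorphism `f ⊗ id`, for `f : A → B ⊗ C`. -/
def tensorId (f : A →⋆ₐ[ℂ] SpatialTensor B C) (D : Type u) [CStarAlgebra D] :
    SpatialTensor A D →⋆ₐ[ℂ] SpatialTensor₃ B C D :=
  lift (algTensorId f D) (norm_algTensorId_le f)

lemma tensorId_tmul (f : A →⋆ₐ[ℂ] SpatialTensor B C) (a : A) (d : D) :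
    tensorId f D (tmul a d) = leg₁₂ B C D (f a) * leg₃ B C D d :=
  (lift_coeHom _ _ _).trans (algTensorId_tmul f a d)

/-- The homomorphism `id ⊗ f` on the algebraic tensor product, for `f : D → B ⊗ C`. -/
def algIdTensor (A : Type u) [CStarAlgebra A] (f : D →⋆ₐ[ℂ] SpatialTensor B C) :
    (A ⊗[ℂ] D) →⋆ₐ[ℂ] SpatialTensor₃ A B C :=
  algTensorLift (leg₁ A B C) ((leg₂₃ A B C).comp f) fun _ d => commute_leg₁_leg₂₃ _ (f d)

lemma algIdTensor_tmul (f : D →⋆ₐ[ℂ] SpatialTensor B C) (a : A) (d : D) :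
    algIdTensor A f (a ⊗ₜ d) = leg₁ A B C a * leg₂₃ A B C (f d) := algTensorLift_tmul _ _ _ _ _

/-- The comparison is now with $\pi\otimes((\rho\otimes\tau)\circ f)$, which acts on the
right-bracketed space; the isometric associator intertwines the two actions. -/
lemma norm_algIdTensor_le (f : D →⋆ₐ[ℂ] SpatialTensor B C) (x : A ⊗[ℂ] D) :
    ‖algIdTensor A f x‖ ≤ (spatialSeminorm A D).toFun x := by
  refine norm_le_of_forall_rep₃ _ (apply_nonneg (spatialSeminorm A D).toSeminorm x) fun r => ?_
  refine le_trans ?_ (norm_repTensor_le r.π ((rep r.ρ r.τ).comp f) x)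
  refine ContinuousLinearMap.opNorm_le_bound _ (norm_nonneg _) fun ξ => ?_
  have key : (HilbertTensor.assocCLM r.H r.K r.L).comp (rep₃ r.π r.ρ r.τ (algIdTensor A f x)) =
      (repTensor r.π ((rep r.ρ r.τ).comp f) x).comp (HilbertTensor.assocCLM r.H r.K r.L) := by
    induction x with
    | zero => simp only [map_zero, ContinuousLinearMap.comp_zero, ContinuousLinearMap.zero_comp]
    | add a b ha hb =>
      simp only [map_add, ContinuousLinearMap.comp_add, ContinuousLinearMap.add_comp, ha, hb]
    | tmul a d =>
      rw [algIdTensor_tmul, map_mul, rep₃_leg₁, ContinuousLinearMap.mul_def,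
        ← ContinuousLinearMap.comp_assoc, HilbertTensor.assocCLM_comp_opTensor,
        ContinuousLinearMap.comp_assoc, assocCLM_comp_rep₃_leg₂₃, ← ContinuousLinearMap.comp_assoc,
        ← ContinuousLinearMap.mul_def, opTensor_one, ← opTensor_mul, mul_one, one_mul]
      rfl
  rw [← HilbertTensor.norm_assocCLM, ← ContinuousLinearMap.comp_apply, key,
    ContinuousLinearMap.comp_apply]
  refine (ContinuousLinearMap.le_opNorm _ _).trans_eq ?_
  rw [HilbertTensor.norm_assocCLM]

/-- The homomorphism `id ⊗ f`, for `f : D → B ⊗ C`. -/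
def idTensor (A : Type u) [CStarAlgebra A] (f : D →⋆ₐ[ℂ] SpatialTensor B C) :
    SpatialTensor A D →⋆ₐ[ℂ] SpatialTensor₃ A B C :=
  lift (algIdTensor A f) (norm_algIdTensor_le f)

lemma idTensor_tmul (f : D →⋆ₐ[ℂ] SpatialTensor B C) (a : A) (d : D) :
    idTensor A f (tmul a d) = leg₁ A B C a * leg₂₃ A B C (f d) :=
  (lift_coeHom _ _ _).trans (algIdTensor_tmul f a d)

/-- `*`-homomorphisms agreeing on elementary tensors are equal. -/
lemma hom_ext_tmul {E : Type w} [CStarAlgebra E] {f g : SpatialTensor A B →⋆ₐ[ℂ] E}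
    (h : ∀ a b, f (tmul a b) = g (tmul a b)) : f = g :=
  hom_ext fun x => by
    induction x with
    | zero => simp only [map_zero]
    | add a b ha hb => simp only [map_add, ha, hb]
    | tmul a b => exact h a b

/-! ### Compatibility of $f\otimes\mathrm{id}$ and $\mathrm{id}\otimes f$ with connecting maps -/

section Naturality

variable {A' B' C' D' : Type u} [CStarAlgebra A'] [CStarAlgebra B'] [CStarAlgebra C']
  [CStarAlgebra D']

lemma map₃_comp_tensorId {f : A →⋆ₐ[ℂ] SpatialTensor B C} {f' : A' →⋆ₐ[ℂ] SpatialTensor B' C'}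
    {α : A →⋆ₐ[ℂ] A'} {β : B →⋆ₐ[ℂ] B'} {γ : C →⋆ₐ[ℂ] C'} (δ : D →⋆ₐ[ℂ] D')
    (h : (map β γ).comp f = f'.comp α) :
    (map₃ β γ δ).comp (tensorId f D) = (tensorId f' D').comp (map α δ) :=
  hom_ext_tmul fun a d => by
    have h1 := DFunLike.congr_fun (map_leg₁₂ β γ δ) (f a)
    have h2 := DFunLike.congr_fun h a
    rw [StarAlgHom.comp_apply, StarAlgHom.comp_apply] at h1 h2
    rw [StarAlgHom.comp_apply, StarAlgHom.comp_apply, tensorId_tmul, map_tmul, tensorId_tmul,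
      map_mul, map_leg₃, h1, h2]

lemma map₃_comp_idTensor {f : D →⋆ₐ[ℂ] SpatialTensor B C} {f' : D' →⋆ₐ[ℂ] SpatialTensor B' C'}
    (α : A →⋆ₐ[ℂ] A') {β : B →⋆ₐ[ℂ] B'} {γ : C →⋆ₐ[ℂ] C'} {δ : D →⋆ₐ[ℂ] D'}
    (h : (map β γ).comp f = f'.comp δ) :
    (map₃ α β γ).comp (idTensor A f) = (idTensor A' f').comp (map α δ) :=
  hom_ext_tmul fun a d => by
    have h1 := DFunLike.congr_fun (map_leg₂₃ α β γ) (f d)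
    have h2 := DFunLike.congr_fun h d
    rw [StarAlgHom.comp_apply, StarAlgHom.comp_apply] at h1 h2
    rw [StarAlgHom.comp_apply, StarAlgHom.comp_apply, idTensor_tmul, map_tmul, idTensor_tmul,
      map_mul, map_leg₁, h1, h2]

end Naturality

end SpatialTensor

/-! ### The comultiplication of `C(SU_q(n))` -/

namespace CSUq

open SpatialTensor (tmul inclLeft inclRight leg₁ leg₃ leg₁₂ leg₂₃ tensorId idTensor)

variable {q : ℝ} {n : ℕ}

/-- The comultiplication of `C(SU_q(n))`. -/
def comul (q : ℝ) (n : ℕ) : CSUq q n →⋆ₐ[ℂ] SpatialTensor (CSUq q n) (CSUq q n) :=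
  lift _ ((isSUqMatrix.map (inclLeft (CSUq q n) (CSUq q n))).mul
    (isSUqMatrix.map (inclRight (CSUq q n) (CSUq q n))) fun _ _ _ _ =>
      SpatialTensor.commute_incl _ _)

lemma comul_u (i j : Fin n) : comul q n (u q n i j) = ∑ k, tmul (u q n i k) (u q n k j) := by
  refine (lift_u _ _ i j).trans ?_
  simp only [SpatialTensor.inclLeft_mul_inclRight]

lemma comul_u' (i j : Fin n) : comul q n (u q n i j) =
    ∑ k, inclLeft _ _ (u q n i k) * inclRight _ _ (u q n k j) := lift_u _ _ i j

/-- Restriction turns $u$ into a block matrix, and block matrices multiply blockwise. The summand at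
the last index contributes only $1\otimes1$, in the corner. -/
lemma map_restrict_comp_comul : (SpatialTensor.map (restrict q n) (restrict q n)).comp
    (comul q (n + 1)) = (comul q n).comp (restrict q n) := by
  refine hom_ext fun i j => ?_
  have hl : ∀ a : CSUq q n, (tmul 0 a : SpatialTensor (CSUq q n) (CSUq q n)) = 0 := fun a => by
    rw [tmul, TensorProduct.zero_tmul, map_zero]
  have hr : ∀ a : CSUq q n, (tmul a 0 : SpatialTensor (CSUq q n) (CSUq q n)) = 0 := fun a => by
    rw [tmul, TensorProduct.tmul_zero, map_zero]
  have h1 : (tmul 1 1 : SpatialTensor (CSUq q n) (CSUq q n)) = 1 :=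
    map_one (SpatialTensor.coeHom (CSUq q n) (CSUq q n))
  rw [StarAlgHom.comp_apply, StarAlgHom.comp_apply, comul_u, map_sum, restrict_u,
    Fin.sum_univ_castSucc]
  simp only [SpatialTensor.map_tmul, restrict_u]
  induction i using Fin.lastCases with
  | last =>
    induction j using Fin.lastCases with
    | last => simp [blockOne_last_left, hl, h1]
    | cast j => simp [blockOne_last_left, hr, hl]
  | cast i =>
    induction j using Fin.lastCases with
    | last => simp [blockOne_last_right, hr, hl]
    | cast j => simp [blockOne_last_right, hl, comul_u]

/-- On $u_{ij}$ both sides are $\sum_{k,l}u_{ik}\otimes u_{kl}\otimes u_{lj}$. -/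
lemma comul_coassoc : (tensorId (comul q n) (CSUq q n)).comp (comul q n) =
    (idTensor (CSUq q n) (comul q n)).comp (comul q n) := by
  refine hom_ext fun i j => ?_
  rw [StarAlgHom.comp_apply, StarAlgHom.comp_apply, comul_u, map_sum, map_sum]
  simp only [SpatialTensor.tensorId_tmul, SpatialTensor.idTensor_tmul, comul_u', map_sum, map_mul,
    SpatialTensor.leg₁₂_inclLeft, SpatialTensor.leg₂₃_inclRight, SpatialTensor.leg₁₂_inclRight,
    Finset.sum_mul, Finset.mul_sum]
  rw [Finset.sum_comm]
  simp only [mul_assoc]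

end CSUq

/-! ### Density -/

/-- If `h` and `g` have commuting ranges and `h a` is approximated by elements of `f(A) g(A)` for
`a` in a set of generators, then so is every element of `h(A) g(A)`. -/
lemma dense_span_mul_of_generators {A T : Type u} [CStarAlgebra A] [CStarAlgebra T]
    (f g h : A →⋆ₐ[ℂ] T) (hc : ∀ a b, Commute (h a) (g b)) {s : Set A}
    (hs : Dense (Algebra.adjoin ℂ s : Set A))
    (hsW : ∀ a ∈ s, h a ∈ Submodule.span ℂ {x : T | ∃ a b, x = f a * g b})
    (ht : Dense (Submodule.span ℂ {x : T | ∃ a b, x = h a * g b} : Set T)) :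
    Dense (Submodule.span ℂ {x : T | ∃ a b, x = f a * g b} : Set T) := by
  set V := Submodule.span ℂ {x : T | ∃ a b, x = f a * g b} with hV
  -- `V` is stable under $f(A)$ on the left and $g(A)$ on the right, though in general not an
  -- algebra.
  have hVg : ∀ x ∈ V, ∀ b, x * g b ∈ V := fun x hx b => by
    induction hx using Submodule.span_induction with
    | mem x hx =>
      obtain ⟨a, c, rfl⟩ := hx
      exact Submodule.subset_span ⟨a, c * b, by rw [map_mul, mul_assoc]⟩
    | zero => rw [zero_mul]; exact zero_mem V
    | add x y _ _ hx hy => rw [add_mul]; exact add_mem hx hy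
    | smul c x _ hx => rw [smul_mul_assoc]; exact V.smul_mem c hx
  have hfV : ∀ x ∈ V, ∀ a, f a * x ∈ V := fun x hx a => by
    induction hx using Submodule.span_induction with
    | mem x hx =>
      obtain ⟨b, c, rfl⟩ := hx
      exact Submodule.subset_span ⟨a * b, c, by rw [map_mul, mul_assoc]⟩
    | zero => rw [mul_zero]; exact zero_mem V
    | add x y _ _ hx hy => rw [mul_add]; exact add_mem hx hy
    | smul c x _ hx => rw [mul_smul_comm]; exact V.smul_mem c hx
  -- Since `h b` commutes with `g c`, one has `f a * g c * h b = f a * h b * g c`, which stays in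
  -- `V`. Hence the elements whose image under `h` lies in `V` are closed under products.
  have hVh : ∀ x ∈ V, ∀ b, h b ∈ V → x * h b ∈ V := fun x hx b hb => by
    induction hx using Submodule.span_induction with
    | mem x hx =>
      obtain ⟨a, c, rfl⟩ := hx
      rw [mul_assoc, ← (hc b c).eq, ← mul_assoc]
      exact hVg _ (hfV _ hb a) c
    | zero => rw [zero_mul]; exact zero_mem V
    | add x y _ _ hx hy => rw [add_mul]; exact add_mem hx hy
    | smul c x _ hx => rw [smul_mul_assoc]; exact V.smul_mem c hx
  have h1 : (1 : T) ∈ V := Submodule.subset_span ⟨1, 1, by rw [map_one, map_one, one_mul]⟩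
  have hadj : ∀ a ∈ Algebra.adjoin ℂ s, h a ∈ V := fun a ha => by
    induction ha using Algebra.adjoin_induction with
    | mem a ha => exact hsW a ha
    | algebraMap c =>
      rw [AlgHomClass.commutes, Algebra.algebraMap_eq_smul_one]
      exact V.smul_mem c h1
    | add a b _ _ ha hb => rw [map_add]; exact add_mem ha hb
    | mul a b _ _ ha hb => rw [map_mul]; exact hVh _ ha b hb
  have hcl : Submodule.span ℂ {x : T | ∃ a b, x = h a * g b} ≤ V.topologicalClosure := by
    refine Submodule.span_le.2 ?_
    rintro _ ⟨a, b, rfl⟩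
    have hcont : Continuous fun a => h a * g b :=
      (starAlgHom_continuous h).mul continuous_const
    exact map_mem_closure (f := fun a => h a * g b) hcont (hs a) fun a ha => hVg _ (hadj a ha) b
  exact dense_closure.1 (ht.mono hcl)

lemma SpatialTensor.dense_span_tmul (A B : Type u) [CStarAlgebra A] [CStarAlgebra B] :
    Dense (Submodule.span ℂ {x : SpatialTensor A B | ∃ a b, x = tmul a b} :
      Set (SpatialTensor A B)) := by
  refine (spatialSeminorm A B).denseRange_coe.mono ?_
  rintro _ ⟨x, rfl⟩
  change coeHom A B x ∈ _
  induction x with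
  | zero => rw [map_zero]; exact zero_mem _
  | add a b ha hb => rw [map_add]; exact add_mem ha hb
  | tmul a b => exact Submodule.subset_span ⟨a, b, rfl⟩

namespace CSUq

open SpatialTensor (tmul inclLeft inclRight)

variable {q : ℝ} {n : ℕ}

/-- The involution maps the dense polynomial algebra onto a dense set. The adjoints serve as
generators for $\Delta(A)(A\otimes1)$, where unitarity produces $1\otimes u_{ij}^*$. -/
lemma dense_adjoin_star_u (hq : q ≠ 0) : Dense (Algebra.adjoin ℂ
    (Set.range fun i : Fin n × Fin n => star (u q n i.1 i.2)) : Set (CSUq q n)) := by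
  have h : DenseRange (fun x : polySubalgebra q n => star (x : CSUq q n)) :=
    star_involutive.surjective.denseRange.comp
      (dense_polySubalgebra hq).denseRange_val continuous_star
  refine h.mono ?_
  rintro _ ⟨⟨x, hx⟩, rfl⟩
  change star x ∈ _
  induction hx using Algebra.adjoin_induction with
  | mem a ha =>
    obtain ⟨i, rfl⟩ := ha
    exact Algebra.subset_adjoin ⟨i, rfl⟩
  | algebraMap c => rw [← algebraMap_star_comm]; exact Subalgebra.algebraMap_mem _ _
  | add a b _ _ ha hb => rw [star_add]; exact add_mem ha hb
  | mul a b _ _ ha hb => rw [star_mul]; exact mul_mem hb ha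

/-- Expanding $\Delta$ leaves an inner sum $uu^*=1$ in the second leg. Unitarity here takes the
place of an antipode. -/
lemma sum_comul_mul_inclRight (i k : Fin n) :
    ∑ j, comul q n (u q n i j) * inclRight _ _ (star (u q n k j)) =
      inclLeft _ _ (u q n i k) := by
  simp_rw [comul_u', Finset.sum_mul, mul_assoc, ← map_mul]
  rw [Finset.sum_comm]
  simp_rw [← Finset.mul_sum, ← map_sum, isSUqMatrix.mul_star]
  simp [apply_ite (inclRight (CSUq q n) (CSUq q n))]

lemma sum_inclLeft_mul_comul (i j : Fin n) :
    ∑ k, inclLeft _ _ (star (u q n k i)) * comul q n (u q n k j) =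
      inclRight _ _ (u q n i j) := by
  simp_rw [comul_u', Finset.mul_sum, ← mul_assoc, ← map_mul]
  rw [Finset.sum_comm]
  simp_rw [← Finset.sum_mul, ← map_sum, isSUqMatrix.star_mul]
  simp [apply_ite (inclLeft (CSUq q n) (CSUq q n))]

/-- `Δ(A)(1 ⊗ A)` is dense in `A ⊗ A`. -/
lemma dense_comul_mul_inclRight (hq : q ≠ 0) : Dense (Submodule.span ℂ
    {x | ∃ a b, x = comul q n a * inclRight (CSUq q n) (CSUq q n) b} :
      Set (SpatialTensor (CSUq q n) (CSUq q n))) := by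
  refine dense_span_mul_of_generators _ _ (inclLeft (CSUq q n) (CSUq q n))
    SpatialTensor.commute_incl (dense_polySubalgebra hq) ?_ ?_
  · rintro _ ⟨⟨i, k⟩, rfl⟩
    rw [← sum_comul_mul_inclRight]
    exact sum_mem fun j _ => Submodule.subset_span ⟨_, _, rfl⟩
  · simp_rw [SpatialTensor.inclLeft_mul_inclRight]
    exact SpatialTensor.dense_span_tmul _ _

/-- `Δ(A)(A ⊗ 1)` is dense in `A ⊗ A`. -/
lemma dense_comul_mul_inclLeft (hq : q ≠ 0) : Dense (Submodule.span ℂ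
    {x | ∃ a b, x = comul q n a * inclLeft (CSUq q n) (CSUq q n) b} :
      Set (SpatialTensor (CSUq q n) (CSUq q n))) := by
  refine dense_span_mul_of_generators _ _ (inclRight (CSUq q n) (CSUq q n))
    (fun a b => (SpatialTensor.commute_incl b a).symm) (dense_adjoin_star_u hq) ?_ ?_
  · rintro _ ⟨⟨i, j⟩, rfl⟩
    -- The cancellation identity has its first-leg factor to the left of $\Delta$; taking adjoints
    -- moves it to the right, as required.
    have h := congrArg star (sum_inclLeft_mul_comul (q := q) i j)
    rw [← map_star, star_sum] at h
    rw [← h]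
    refine sum_mem fun k _ => Submodule.subset_span ⟨star (u q n k j), u q n k i, ?_⟩
    rw [star_mul, ← map_star, ← map_star, star_star]
  · simp_rw [← (SpatialTensor.commute_incl _ _).eq, SpatialTensor.inclLeft_mul_inclRight]
    refine (SpatialTensor.dense_span_tmul (CSUq q n) (CSUq q n)).mono (Submodule.span_mono ?_)
    rintro _ ⟨a, b, rfl⟩
    exact ⟨b, a, rfl⟩

end CSUq

/-! ### Inverse limits -/

/-- Above level `n` preimages are chosen successively; below it the coordinates are forced. The
induction shifts the system by one and prepends the image under `f 0`. -/
lemma exists_compatible_eq : ∀ (n : ℕ) {A : ℕ → Type u} (f : ∀ n, A (n + 1) → A n)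
    (_ : ∀ n, Function.Surjective (f n)) (a : A n),
    ∃ x : ∀ k, A k, (∀ k, f k (x (k + 1)) = x k) ∧ x n = a
  | 0, A, f, hf, a => ⟨fun k => Nat.rec a (fun k y => (hf k y).choose) k,
      fun k => (hf k _).choose_spec, rfl⟩
  | n + 1, A, f, hf, a => by
    obtain ⟨x, hx, rfl⟩ := exists_compatible_eq n (A := fun k => A (k + 1)) (fun k => f (k + 1))
      (fun k => hf (k + 1)) a
    refine ⟨fun k => Nat.casesOn k (f 0 (x 0)) x, fun k => ?_, rfl⟩
    cases k with
    | zero => rfl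
    | succ k => exact hx k

namespace CStarInverseSystem

variable {A : ℕ → Type u} [∀ n, CStarAlgebra (A n)] (S : CStarInverseSystem A)

lemma exists_lim_apply_eq (hS : S.IsSurjective) (n : ℕ) (a : A n) : ∃ x : S.lim, x.1 n = a := by
  obtain ⟨x, hx, hxa⟩ := exists_compatible_eq n (fun k => S.map k) hS a
  exact ⟨⟨x, hx⟩, hxa⟩

lemma norm_apply_le (x : S.lim) {n m : ℕ} (h : n ≤ m) : ‖x.1 n‖ ≤ ‖x.1 m‖ := by
  induction m, h using Nat.le_induction with
  | base => exact le_rfl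
  | succ m _ ih =>
    refine ih.trans ?_
    rw [← x.2 m]
    exact NonUnitalStarAlgHom.norm_apply_le (S.map m) _

/-- The canonical homomorphism of the inverse limit to a term of the system. -/
def proj (n : ℕ) : S.lim →ₗ[ℂ] A n where
  toFun x := x.1 n
  map_add' _ _ := rfl
  map_smul' _ _ := rfl

/-- A subset of an inverse limit is dense if all its projections are. -/
lemma dense_of_dense_proj {V : Set S.lim} (h : ∀ n, Dense (S.proj n '' V)) : Dense V := by
  intro x
  -- A diagonal choice: the $n$th approximant is controlled at level $n$ only, and contractivity of
  -- the connecting maps gives the same bound at all lower levels, so the sequence converges in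
  -- every coordinate.
  have h1 : ∀ n : ℕ, ∃ v ∈ V, ‖(x - v).1 n‖ < 1 / ((n : ℝ) + 1) := fun n => by
    obtain ⟨_, ⟨v, hv, rfl⟩, hd⟩ := (h n).exists_dist_lt (x.1 n)
      (Nat.one_div_pos_of_nat (n := n) (α := ℝ))
    exact ⟨v, hv, by rwa [dist_eq_norm] at hd⟩
  choose v hv hxv using h1
  refine mem_closure_of_tendsto (b := Filter.atTop) (f := v) ?_ (Filter.Eventually.of_forall hv)
  rw [tendsto_subtype_rng, tendsto_pi_nhds]
  intro n
  rw [tendsto_iff_norm_sub_tendsto_zero]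
  refine squeeze_zero_norm' ?_ tendsto_one_div_add_atTop_nhds_zero_nat
  filter_upwards [Filter.eventually_ge_atTop n] with m hm
  rw [norm_norm, norm_sub_rev]
  exact (S.norm_apply_le (x - v m) hm).trans (hxv m).le

lemma dense_span_of_proj {X : Set S.lim} {Y : ∀ n, Set (A n)}
    (hY : ∀ n, Dense (Submodule.span ℂ (Y n) : Set (A n))) (h : ∀ n, Y n ⊆ S.proj n '' X) :
    Dense (Submodule.span ℂ X : Set S.lim) :=
  S.dense_of_dense_proj fun n => (hY n).mono (by
    rw [← Submodule.map_coe, Submodule.map_span]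
    exact Submodule.span_mono (h n))

lemma continuous_limMap {B : ℕ → Type u} [∀ n, CStarAlgebra (B n)] {S : CStarInverseSystem A}
    {T : CStarInverseSystem B} (f : ∀ n, A n →⋆ₐ[ℂ] B n)
    (hf : ∀ n, (T.map n).comp (f (n + 1)) = (f n).comp (S.map n)) : Continuous (limMap f hf) :=
  Continuous.subtype_mk (continuous_pi fun n =>
    (starAlgHom_continuous (f n)).comp ((continuous_apply n).comp continuous_subtype_val)) _

/-- The inverse limit of a sequence of compact quantum groups is a `σ`-C*-quantum group. -/
theorem isQuantumGroup_limMap {S : CStarInverseSystem A} (hS : S.IsSurjective)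
    (Δ : ∀ n, A n →⋆ₐ[ℂ] SpatialTensor (A n) (A n))
    (hΔ : ∀ n, (SpatialTensor.map (S.map n) (S.map n)).comp (Δ (n + 1)) = (Δ n).comp (S.map n))
    (hassoc : ∀ n, (SpatialTensor.tensorId (Δ n) (A n)).comp (Δ n) =
      (SpatialTensor.idTensor (A n) (Δ n)).comp (Δ n))
    (hl : ∀ n, Dense (Submodule.span ℂ {x | ∃ a b, x = Δ n a * SpatialTensor.inclLeft (A n) (A n) b} :
      Set (SpatialTensor (A n) (A n))))
    (hr : ∀ n, Dense (Submodule.span ℂ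
      {x | ∃ a b, x = Δ n a * SpatialTensor.inclRight (A n) (A n) b} :
      Set (SpatialTensor (A n) (A n)))) :
    S.IsQuantumGroup (limMap (S := S) (T := S.tensor S) Δ hΔ) where
  surjective := hS
  continuous := continuous_limMap _ _
  coassoc := by
    refine ⟨limMap (S := S.tensor S) (T := S.tensor₃ S S)
        (fun n => SpatialTensor.tensorId (Δ n) (A n))
        (fun n => SpatialTensor.map₃_comp_tensorId (S.map n) (hΔ n)),
      limMap (S := S.tensor S) (T := S.tensor₃ S S)
        (fun n => SpatialTensor.idTensor (A n) (Δ n))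
        (fun n => SpatialTensor.map₃_comp_idTensor (S.map n) (hΔ n)),
      ⟨continuous_limMap _ _, fun a b => ?_⟩, ⟨continuous_limMap _ _, fun a b => ?_⟩,
      StarAlgHom.ext fun a => ?_⟩
    · refine Subtype.ext (funext fun n => ?_)
      exact (congrArg _ (SpatialTensor.inclLeft_mul_inclRight (a.1 n) (b.1 n))).trans
        (SpatialTensor.tensorId_tmul _ _ _)
    · refine Subtype.ext (funext fun n => ?_)
      exact (congrArg _ (SpatialTensor.inclLeft_mul_inclRight (a.1 n) (b.1 n))).trans
        (SpatialTensor.idTensor_tmul _ _ _)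
    · exact Subtype.ext (funext fun n => DFunLike.congr_fun (hassoc n) (a.1 n))
  dense_left := by
    refine (S.tensor S).dense_span_of_proj hl fun n => ?_
    rintro _ ⟨a, b, rfl⟩
    -- Factors at level `n` are lifted to the limit, so each spanning product at that level is the
    -- projection of one in the limit.
    obtain ⟨x, rfl⟩ := S.exists_lim_apply_eq hS n a
    obtain ⟨y, rfl⟩ := S.exists_lim_apply_eq hS n b
    exact ⟨_, ⟨x, y, rfl⟩, rfl⟩
  dense_right := by
    refine (S.tensor S).dense_span_of_proj hr fun n => ?_
    rintro _ ⟨a, b, rfl⟩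
    obtain ⟨x, rfl⟩ := S.exists_lim_apply_eq hS n a
    obtain ⟨y, rfl⟩ := S.exists_lim_apply_eq hS n b
    exact ⟨_, ⟨x, y, rfl⟩, rfl⟩

end CStarInverseSystem

end

theorem mainTheorem3 (q : ℝ) (hq0 : 0 < q) (hq1 : q < 1) :
    ∃ (θ : ∀ n, CSUq q (n + 2) →⋆ₐ[ℂ] CSUq q (n + 1))
      (Δ : ∀ n, CSUq q (n + 1) →⋆ₐ[ℂ] SpatialTensor (CSUq q (n + 1)) (CSUq q (n + 1))),
      (∀ (n : ℕ) (i j : Fin (n + 2)), θ n (CSUq.u q (n + 2) i j) =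
        if h : i.val < n + 1 ∧ j.val < n + 1 then
          CSUq.u q (n + 1) ⟨i.val, h.1⟩ ⟨j.val, h.2⟩
        else if i = j then 1 else 0) ∧
      (∀ n, Function.Surjective (θ n)) ∧
      (∀ (n : ℕ) (i j : Fin (n + 1)), Δ n (CSUq.u q (n + 1) i j) =
        ∑ k, SpatialTensor.tmul (CSUq.u q (n + 1) i k) (CSUq.u q (n + 1) k j)) ∧
      ∃ hΔ : ∀ n, (SpatialTensor.map (θ n) (θ n)).comp (Δ (n + 1)) = (Δ n).comp (θ n),
        (suqSystem q θ).IsQuantumGroup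
          (CStarInverseSystem.limMap (S := suqSystem q θ)
            (T := (suqSystem q θ).tensor (suqSystem q θ)) Δ hΔ) := by
  have hq : q ≠ 0 := hq0.ne'
  -- The system is indexed from zero, so its term `n` is $C(SU_q(n+1))$ and its connecting map `n`
  -- is $\theta_{n+2}$.
  exact ⟨fun n => CSUq.restrict q (n + 1), fun n => CSUq.comul q (n + 1),
    fun n i j => CSUq.restrict_u i j, fun n => CSUq.restrict_surjective hq,
    fun n i j => CSUq.comul_u i j, fun n => CSUq.map_restrict_comp_comul,
    CStarInverseSystem.isQuantumGroup_limMap (fun n => CSUq.restrict_surjective hq) _ _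
      (fun n => CSUq.comul_coassoc) (fun n => CSUq.dense_comul_mul_inclLeft hq)
      (fun n => CSUq.dense_comul_mul_inclRight hq)⟩
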